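/- Chromotopologies. Let $C\subset\mathbb F_2^N$ be a doubly even linear code (every codeword has weight divisible by $4$) of dimension $k$. The chromotopology $A_{(N,k)}=[0,1]^N/C$ is the edge-coloured bipartite graph whose vertices are the cosets of $C$ in $\mathbb F_2^N$, where the edge of colour $c\in\{1,\dots,N\}$ at $v$ leads to $v+e_c$; cosets of even weight are white, those of odd weight are black. With the cyclic order (rainbow) $(1,2,\dots,N)$ of the colours it defines a closed surface $X_{(N,k)}$: a quadrilateral $2$-cell is attached to every closed path of length four whose colours alternate between $c$ and $c+1$, for $c=1,\dots,N$ (with $N+1$ read as $1$). (For $N=1$, where there are no such paths, $X_{(1,0)}$ is the sphere $B_1$ itself.) Let $B_N=\mathbb{CP}^1$ with a white vertex at $0$, a black vertex at $\infty$ and the edge of colour $c$ on the ray of argument $2\pi c/N$. The surface $X_{(N,k)}$ maps to $B_N$, white vertices to $0$, black vertices to $\infty$, edges of colour $c$ to the edge of colour $c$, and every $c/(c+1)$ face to the $c/(c+1)$ face of $B_N$, with a double point exactly over the face centres (the $N$-th roots of $-1$) when $N\ge 2$. Away from the face centres this map is a covering, whose fibre over $0$ is the set of white vertices; its monodromy group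 is the image of $\pi_1(B_N\setminus\{x^N=-1\},0)$ in the permutations of the white vertices. For $1\le c\le N$ let $\rho_c$ be the permutation of the white vertices that exchanges the two white vertices of every $c/(c+1)$ face, that is, follows colour $c$ and then colour $c+1$ (so $\rho_1=\mathrm{id}$ if $N=1$). The exterior tensor product $A=A_{(N_1,k_1)}\otimes A_{(N_2,k_2)}$ consists of one copy of $A_{(N_1,k_1)}$ for every vertex of $A_{(N_2,k_2)}$, with black and white interchanged in the copies at black vertices; corresponding vertices of the copies at $v$ and $v'$ are joined by an edge of colour $N_1+c$ when $v,v'$ are joined by colour $c$ in $A_{(N_2,k_2)}$. Its surface is denoted $X_{(N_1,k_1)}\otimes X_{(N_2,k_2)}$. Theorem. Let $N_1,N_2\ge 1$, let $A_{(N_1,k_1)},A_{(N_2,k_2)}$ be chromotopologies as above, $N=N_1+N_2$, $k=k_1+k_2$. Then $A=A_{(N_1,k_1)}\otimes A_{(N_2,k_2)}$ is isomorphic to the quotient of the $N$-cube by a $k$-dimensional doubly even code. Let $\rho_{c,1}$, $\rho_{c,2}$, $\rho_c$ be the permutations above for $A_{(N_1,k_1)}$, $A_{(N_2,k_2)}$,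 $A$. The monodromy groups of $X_{(N_1,k_1)}$ over $B_{N_1}$, of $X_{(N_2,k_2)}$ over $B_{N_2}$ and of $X_{(N_1,k_1)}\otimes X_{(N_2,k_2)}$ over $B_N$ are generated by the $\rho_{c,1}$ ($1\le c\le N_1-1$), the $\rho_{c,2}$ ($1\le c\le N_2-1$) and the $\rho_c$ ($1\le c\le N-1$), respectively. Put $m_i=2^{N_i-k_i-1}$. The white vertices of $A_{(N_i,k_i)}$ can be labelled $1,\dots,m_i$, and if $N_i\ge2$ then every $\rho_{c,i}$ is a product of disjoint $2$-cycles. For all such labellings there is a labelling of the white vertices of $A$ by $1,\dots,2^{N-k-1}$ such that, as permutations of the labels: (a) for $1\le c\le N_1-1$, $\rho_c=\rho_c^{(1)}\rho_c^{(2)}\cdots\rho_c^{(2^{N_2-k_2})}$, where $\rho_c^{(j)}$ is $\rho_{c,1}$ with $(j-1)m_1$ added to each entry of its $2$-cycles; (b) for $N_1+1\le c\le N-1$, $\rho_c=\rho_c^{(1)}\rho_c^{(2)}\cdots\rho_c^{(2^{N_1-k_1})}$, where $\rho_c^{(i)}$ is $\rho_{c-N_1,2}$ with each entry $j$ of its $2$-cycles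 replaced by $(j-1)2^{N_1-k_1}+i$; (c) if $N_1\ge 2$, then $\rho_{N_1}=\prod_{J=1}^{2^{N_2-k_2}}\rho_{N_1}^{(J)}$, where $\rho_{N_1}^{(J)}$ is obtained from any expression of $\rho_{N_1,1}$ as a product of disjoint $2$-cycles (the same expression, with the same order of the two entries of each cycle, for all $J$) by $$(i,l)\mapsto\bigl((J-1)m_1+i,\ (J-1+(-1)^{J+1})m_1+l\bigr);$$ for all $N_1\ge 1$, $\rho_{N_1}$ maps $(J-1)m_1+i$ to $(J-1+(-1)^{J+1})m_1+\rho_{N_1,1}(i)$ for $1\le J\le 2^{N_2-k_2}$, $1\le i\le m_1$; (d) $\rho_N=\rho_1\rho_2\cdots\rho_{N-1}$; if $N_2\ge 2$, then $\rho_N=\prod_{I=1}^{2^{N_1-k_1}}\rho_N^{(I)}$, where $\rho_N^{(I)}$ is obtained from any expression of $\rho_{N_2,2}$ as a product of disjoint $2$-cycles (the same expression for all $I$) by $$(j,l)\mapsto\bigl((j-1)2^{N_1-k_1}+I,\ (l-1)2^{N_1-k_1}+I\pm m_1\bigr),$$ with the sign $+$ for $I\le m_1$ and $-$ otherwise; for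 all $N_2\ge 1$, $\rho_N$ maps $(j-1)2^{N_1-k_1}+I$ to $(\rho_{N_2,2}(j)-1)2^{N_1-k_1}+I\pm m_1$ for $1\le I\le 2^{N_1-k_1}$, $1\le j\le m_2$, with the same rule for the sign. -/

import Mathlib

open Equiv

noncomputable section

/-! ## Chromotopologies -/

/-- The data of a chromotopology with colours `1, …, N`: an `N`-regular edge-coloured bipartite graph
in which all two-coloured paths of length four are closed.  The element `c : Fin N` stands for the
colour `c + 1`; `edge c v` is the other end of the edge of that colour at `v`; vertices of parity
`0` are white, those of parity `1` are black. -/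
structure Chromotopology (N : ℕ) where
  V : Type
  edge : Fin N → V → V
  parity : V → ZMod 2
  edge_edge : ∀ c v, edge c (edge c v) = v
  edge_comm : ∀ c d v, edge c (edge d v) = edge d (edge c v)
  parity_edge : ∀ c v, parity (edge c v) = parity v + 1

/-- A binary code of length `N` is doubly even if all weights are divisible by `4`. -/
def DoublyEven {N : ℕ} (C : Submodule (ZMod 2) (Fin N → ZMod 2)) : Prop :=
  ∀ x ∈ C, 4 ∣ hammingNorm x

/-- The sum of the coordinates; on `0/1`-vectors this is the weight modulo `2`. -/
def weightParity (N : ℕ) : (Fin N → ZMod 2) →ₗ[ZMod 2] ZMod 2 :=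
  ∑ i, LinearMap.proj i

theorem weightParity_eq {N : ℕ} (x : Fin N → ZMod 2) :
    weightParity N x = (hammingNorm x : ZMod 2) := by
  have h : ∀ a : ZMod 2, a = if a ≠ 0 then 1 else 0 := by decide
  simp only [weightParity, LinearMap.sum_apply, LinearMap.proj_apply, hammingNorm]
  rw [Finset.sum_congr rfl fun i _ => h (x i), Finset.sum_boole]

theorem DoublyEven.le_ker {N : ℕ} {C : Submodule (ZMod 2) (Fin N → ZMod 2)}
    (h : DoublyEven C) : C ≤ LinearMap.ker (weightParity N) := by
  intro x hx
  rw [LinearMap.mem_ker, weightParity_eq, ZMod.natCast_eq_zero_iff]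
  exact Dvd.dvd.trans (by norm_num) (h x hx)

namespace Chromotopology

/-- The quotient of the coloured `N`-cube by a doubly even code: vertices are the cosets, the edge
of colour `c` changes the `c`-th coordinate, and the even weight vectors are the white vertices. -/
def ofCode {N : ℕ} (C : Submodule (ZMod 2) (Fin N → ZMod 2)) (h : DoublyEven C) :
    Chromotopology N where
  V := (Fin N → ZMod 2) ⧸ C
  edge c v := v + C.mkQ (Pi.single c 1)
  parity := C.liftQ (weightParity N) h.le_ker
  edge_edge c v := by
    rw [add_assoc, ← map_add, ← Pi.single_add, show (1 : ZMod 2) + 1 = 0 from rfl]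
    simp
  edge_comm c d v := by abel
  parity_edge c v := by
    rw [map_add, Submodule.mkQ_apply, Submodule.liftQ_apply]
    simp [weightParity, Finset.sum_apply, Pi.single_apply]

/-- The exterior tensor product: one copy of `A₁` for every vertex of `A₂`, with black and white
interchanged in the copies at black vertices of `A₂`; corresponding vertices of different copies are
joined as in `A₂`, the colour `c` of `A₂` becoming the colour `N₁ + c`. -/
def tensor {N₁ N₂ : ℕ} (A₁ : Chromotopology N₁) (A₂ : Chromotopology N₂) :
    Chromotopology (N₁ + N₂) where
  V := A₁.V × A₂.V
  edge := Fin.addCases (fun c v => (A₁.edge c v.1, v.2)) (fun c v => (v.1, A₂.edge c v.2))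
  parity v := A₁.parity v.1 + A₂.parity v.2
  edge_edge c v := by
    refine Fin.addCases (fun c => ?_) (fun c => ?_) c <;> simp [edge_edge]
  edge_comm c d v := by
    refine Fin.addCases (fun c => ?_) (fun c => ?_) c <;>
      refine Fin.addCases (fun d => ?_) (fun d => ?_) d <;> simp
    · exact A₁.edge_comm c d v.1
    · exact A₂.edge_comm c d v.2
  parity_edge c v := by
    refine Fin.addCases (fun c => ?_) (fun c => ?_) c <;> simp [parity_edge] <;> ring

/-- Isomorphism of chromotopologies. -/
structure Iso {N : ℕ} (A B : Chromotopology N) where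
  toEquiv : A.V ≃ B.V
  map_edge : ∀ c v, toEquiv (A.edge c v) = B.edge c (toEquiv v)
  map_parity : ∀ v, B.parity (toEquiv v) = A.parity v

variable {N : ℕ} (A : Chromotopology N)

/-- The white vertices. -/
def White : Type := {v : A.V // A.parity v = 0}

/-- The permutation `ρ_c` of the white vertices which, for every two-coloured face of colours
`c/(c+1)` (read cyclically in the rainbow `(1, 2, …, N)`), exchanges the two white vertices of the
face: follow the edge of colour `c`, then that of the next colour. -/
def rho (c : Fin N) : Perm A.White where
  toFun w := ⟨A.edge (finRotate N c) (A.edge c w.1), by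
    rw [A.parity_edge, A.parity_edge, w.2]; rfl⟩
  invFun w := ⟨A.edge c (A.edge (finRotate N c) w.1), by
    rw [A.parity_edge, A.parity_edge, w.2]; rfl⟩
  left_inv w := Subtype.ext (by simp only [A.edge_edge])
  right_inv w := Subtype.ext (by simp only [A.edge_edge])

/-! ## The surface over `B_N`

`B_N` is the Riemann sphere with a white vertex at `0`, a black vertex at `∞` and the edge of colour
`c` on the ray of argument `2πc/N`; the centres of its faces are the `N`-th roots of `-1`.

Cutting every quadrilateral two-coloured face of the surface of `A` from its centre to the midpoints
of its four sides gives four corners, and the `N` corners at a vertex form a closed disc around it.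
So the surface is obtained by gluing one disc for every vertex: a copy of `{|z| ≤ 1}` for a white
vertex and a copy of `{|z| ≥ 1} ∪ {∞}` for a black one, where the discs of the two ends of an edge of
colour `c` are glued along the arc of the unit circle centred at the midpoint of the edge of
colour `c` of `B_N`, between the centres of the two adjacent faces. The projection to `B_N` is `z`. -/

/-- The disc in `B_N` around its white vertex (`q = 0`) or its black vertex. -/
def disc (q : ZMod 2) : Set (OnePoint ℂ) :=
  if q = 0 then {z | ∃ x : ℂ, z = x ∧ ‖x‖ ≤ 1}
  else {z | z = OnePoint.infty ∨ ∃ x : ℂ, z = x ∧ 1 ≤ ‖x‖}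

/-- The arc of the unit circle around the midpoint of the edge of colour `c + 1` of `B_N`. -/
def arc (N : ℕ) (c : Fin N) : Set (OnePoint ℂ) :=
  {z | ∃ θ : ℝ, |θ - 2 * Real.pi * ((c : ℕ) + 1) / N| ≤ Real.pi / N ∧
    z = (Complex.exp (θ * Complex.I) : ℂ)}

/-- The centres of the faces of `B_N`. -/
def centres (N : ℕ) : Set (OnePoint ℂ) := {z | ∃ x : ℂ, z = x ∧ x ^ N = -1}

/-- The disjoint union of the discs of all vertices. -/
abbrev Discs : Type := Σ v : A.V, disc (A.parity v)

/-- The gluing of the discs at the two ends of an edge. -/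
def Glue (p q : A.Discs) : Prop :=
  ∃ c : Fin N, q.1 = A.edge c p.1 ∧ (q.2 : OnePoint ℂ) = p.2 ∧ (p.2 : OnePoint ℂ) ∈ arc N c

/-- The surface of `A` for the rainbow `(1, 2, …, N)`, with the quotient topology. -/
abbrev Surface : Type := Quot A.Glue

/-- The projection of the surface to `B_N`, unramified away from the centres of the faces. -/
def toSphere : A.Surface → OnePoint ℂ :=
  Quot.lift (fun p => (p.2 : OnePoint ℂ)) (by rintro p q ⟨c, -, h, -⟩; exact h.symm)

/-- The part of the projection over the complement of the centres of the faces. -/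
def proj : A.toSphere ⁻¹' (centres N)ᶜ → ((centres N)ᶜ : Set (OnePoint ℂ)) :=
  (centres N)ᶜ.restrictPreimage A.toSphere

theorem zero_mem_compl_centres (N : ℕ) : ((0 : ℂ) : OnePoint ℂ) ∈ (centres N)ᶜ := by
  rintro ⟨x, hx, h⟩
  rw [OnePoint.coe_eq_coe] at hx
  subst hx
  rcases Nat.eq_zero_or_pos N with rfl | hN
  · norm_num at h
  · rw [zero_pow hN.ne'] at h
    norm_num at h

/-- The white vertex of `B_N`, used as base point. -/
def base (N : ℕ) : ((centres N)ᶜ : Set (OnePoint ℂ)) :=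
  ⟨((0 : ℂ) : OnePoint ℂ), zero_mem_compl_centres N⟩

/-- A white vertex as a point of the surface: the centre of its disc. -/
def point (w : A.White) : A.Surface :=
  Quot.mk _ ⟨w.1, ((0 : ℂ) : OnePoint ℂ), by simp [disc, w.2]⟩

/-- The set `S` of permutations of the white vertices generates the monodromy group of the surface
over `B_N`: away from the centres of the faces the projection is a covering map, its fibre over the
white vertex of `B_N` consists of the white vertices, and the image of the fundamental group in the
permutations of this fibre is the group generated by `S`. -/
def MonodromyGeneratedBy (S : Set (Perm A.White)) : Prop :=
  ∃ (cov : IsCoveringMap A.proj) (e : A.White ≃ (A.proj ⁻¹' {base N} : Set _)),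
    (∀ w, ((e w).1 : A.Surface) = A.point w) ∧
    (cov.monodromyPerm (base N)).range =
      (Subgroup.closure S).map (e.permCongrHom : Perm A.White →* Perm _)

/-! ## Labelled permutations -/

/-- A labelling of the white vertices by `1, …, m`. -/
abbrev Labeling (m : ℕ) : Type := A.White ≃ {i : ℕ // i ∈ Finset.Icc 1 m}

variable {A} in
/-- `ρ_c` as a permutation of the labels (all integers that are not labels are fixed). -/
def labeledRho {m : ℕ} (l : A.Labeling m) (c : Fin N) : Perm ℕ :=
  (A.rho c).extendDomain l

end Chromotopology

/-- `L` writes `σ` as a product of disjoint `2`-cycles. -/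
structure IsTwoCycleDecomposition (σ : Perm ℕ) (L : List (ℕ × ℕ)) : Prop where
  nodup : (L.flatMap fun p => [p.1, p.2]).Nodup
  prod_eq : σ = (L.map fun p => swap p.1 p.2).prod

/-- The product of the cycles `(f i, g l)` over the cycles `(i, l)` in the list `L`. -/
def relabel (L : List (ℕ × ℕ)) (f g : ℕ → ℕ) : Perm ℕ :=
  (L.map fun p => swap (f p.1) (g p.2)).prod

/-- The product `s 1 * s 2 * ⋯ * s n`. -/
def orderedProd (n : ℕ) (s : ℕ → Perm ℕ) : Perm ℕ :=
  ((List.range' 1 n).map s).prod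

/-- `J + (-1) ^ (J + 1)`: the partner of `J` in the pairing `1 ↔ 2`, `3 ↔ 4`, … . -/
def partner (J : ℕ) : ℕ := if Odd J then J + 1 else J - 1

end

/-!
Over the complement of all arcs but one the discs glued along that arc form disjoint sheets, so the
projection to `B_N` is a covering away from the face centres. To follow the edges of one colour and
then those of another is an automorphism of the graph, hence of the covering, so the monodromy
commutes with every `ρ_c`. The `ρ_c` generate an abelian group, transitive on the white vertices of
a connected graph, and a permutation commuting with a transitive abelian group is determined by one
value and lies in that group. As a suitable loop around a face centre moves a given `w` to `ρ_c w`,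
the monodromy group is generated by the `ρ_c`.

A white vertex of the tensor product is given by a white end, in each factor, of an edge of the
first colour and by a parity. Read together with the white vertex of `A₂`, the parity gives the
number `J` of a copy of `A₁`; read together with the white vertex of `A₁`, it gives the number `I`
of a copy of `A₂`. Both pairs `(J, i)` and `(j, I)` describe the same label, and each `ρ_c` is
simple in one of them.
-/

noncomputable section

namespace Chromotopology

variable {N : ℕ}

/-- The point of argument `2πt/N` of the unit circle of `B_N`: the midpoint of an edge for integral
`t`, the centre of a face for half-integral `t`. -/
def circlePoint (N : ℕ) (t : ℝ) : Circle := Circle.exp (2 * Real.pi * t / N)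

theorem continuous_circlePoint : Continuous (circlePoint N) := by
  unfold circlePoint
  fun_prop

theorem circlePoint_surjective [NeZero N] : Function.Surjective (circlePoint N) := fun u => by
  obtain ⟨θ, rfl⟩ := Circle.exp_surjective u
  have hN : (N : ℝ) ≠ 0 := NeZero.ne _
  exact ⟨θ * N / (2 * Real.pi), congrArg Circle.exp (by field_simp)⟩

theorem circlePoint_eq_iff [NeZero N] {s t : ℝ} :
    circlePoint N s = circlePoint N t ↔ ∃ n : ℤ, s = t + n * N := by
  have hN : (N : ℝ) ≠ 0 := NeZero.ne _
  rw [circlePoint, circlePoint, Circle.exp_eq_exp]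
  refine exists_congr fun n => ?_
  field_simp

theorem circlePoint_pow [NeZero N] (t : ℝ) :
    (circlePoint N t : ℂ) ^ N = Complex.exp (t * (2 * Real.pi * Complex.I)) := by
  have hN : (N : ℂ) ≠ 0 := NeZero.ne _
  rw [circlePoint, Circle.coe_exp, ← Complex.exp_nat_mul]
  push_cast
  congr 1
  field_simp

theorem circlePoint_natCast_pow [NeZero N] (n : ℕ) : (circlePoint N n : ℂ) ^ N = 1 := by
  rw [circlePoint_pow, Complex.ofReal_natCast, Complex.exp_nat_mul_two_pi_mul_I]

theorem circlePoint_int_add_half_pow [NeZero N] (n : ℤ) :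
    (circlePoint N (n + 1 / 2) : ℂ) ^ N = -1 := by
  rw [circlePoint_pow, Complex.ofReal_add, add_mul, Complex.exp_add, Complex.ofReal_intCast,
    Complex.exp_int_mul_two_pi_mul_I, one_mul, ← Complex.exp_pi_mul_I]
  push_cast
  ring_nf

theorem disc_zero : disc 0 = ((↑) : ℂ → OnePoint ℂ) '' Metric.closedBall 0 1 := by
  ext z
  simp [disc, eq_comm, and_comm]

theorem disc_one : disc 1 = (((↑) : ℂ → OnePoint ℂ) '' Metric.ball 0 1)ᶜ := by
  ext z
  induction z using OnePoint.rec <;> simp [disc]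

theorem coe_mem_disc_zero {x : ℂ} : (x : OnePoint ℂ) ∈ disc 0 ↔ ‖x‖ ≤ 1 := by
  simp [disc]

theorem coe_mem_disc_one {x : ℂ} : (x : OnePoint ℂ) ∈ disc 1 ↔ 1 ≤ ‖x‖ := by
  simp [disc]

theorem mem_disc_zero_or_one (z : OnePoint ℂ) : z ∈ disc 0 ∨ z ∈ disc 1 := by
  rw [disc_zero, disc_one]
  exact or_iff_not_imp_left.2 fun hz h => hz (Set.image_mono Metric.ball_subset_closedBall h)

theorem isClosed_disc (q : ZMod 2) : IsClosed (disc q) := by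
  fin_cases q
  · exact disc_zero ▸ ((isCompact_closedBall 0 1).image OnePoint.continuous_coe).isClosed
  · exact disc_one ▸ (OnePoint.isOpenEmbedding_coe.isOpenMap _ Metric.isOpen_ball).isClosed_compl

theorem circle_mem_disc (u : Circle) (q : ZMod 2) : ((u : ℂ) : OnePoint ℂ) ∈ disc q := by
  fin_cases q
  · exact coe_mem_disc_zero.2 u.norm_coe.le
  · exact coe_mem_disc_one.2 u.norm_coe.ge

theorem exists_circle_of_mem_disc {z : OnePoint ℂ} (h₀ : z ∈ disc 0) (h₁ : z ∈ disc 1) :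
    ∃ u : Circle, z = (u : ℂ) := by
  rw [disc_zero] at h₀
  obtain ⟨x, hx, rfl⟩ := h₀
  have hx' := le_antisymm (mem_closedBall_zero_iff.1 hx) (coe_mem_disc_one.1 h₁)
  exact ⟨⟨x, mem_sphere_zero_iff_norm.2 hx'⟩, rfl⟩

theorem mem_arc_iff {c : Fin N} {z : OnePoint ℂ} :
    z ∈ arc N c ↔ ∃ t : ℝ, |t - ((c : ℕ) + 1)| ≤ 1 / 2 ∧ z = (circlePoint N t : ℂ) := by
  have := c.neZero
  have hN : (0 : ℝ) < N := Nat.cast_pos.2 c.pos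
  have habs (t : ℝ) : |2 * Real.pi * t / N - 2 * Real.pi * ((c : ℕ) + 1) / N| ≤ Real.pi / N ↔
      |t - ((c : ℕ) + 1)| ≤ 1 / 2 := by
    rw [← sub_div, ← mul_sub, abs_div, abs_of_pos hN, div_le_div_iff_of_pos_right hN, abs_mul,
      abs_of_pos Real.two_pi_pos, ← le_div_iff₀' Real.two_pi_pos]
    field_simp
  constructor
  · rintro ⟨θ, hθ, rfl⟩
    obtain ⟨t, rfl⟩ : ∃ t : ℝ, θ = 2 * Real.pi * t / N := ⟨θ * N / (2 * Real.pi), by field_simp⟩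
    exact ⟨t, (habs t).1 hθ, rfl⟩
  · rintro ⟨t, ht, rfl⟩
    exact ⟨_, (habs t).2 ht, rfl⟩

theorem arc_subset_disc (c : Fin N) (q : ZMod 2) : arc N c ⊆ disc q := fun z hz => by
  obtain ⟨t, -, rfl⟩ := mem_arc_iff.1 hz
  exact circle_mem_disc _ q

theorem isClosed_arc (c : Fin N) : IsClosed (arc N c) := by
  have : arc N c = (fun t => ((circlePoint N t : ℂ) : OnePoint ℂ)) ''
      Metric.closedBall ((c : ℕ) + 1 : ℝ) (1 / 2) := by
    ext z
    simp only [mem_arc_iff, Set.mem_image, Metric.mem_closedBall, Real.dist_eq, eq_comm]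
  rw [this]
  refine ((isCompact_closedBall _ _).image ?_).isClosed
  exact OnePoint.continuous_coe.comp (continuous_subtype_val.comp continuous_circlePoint)

theorem exists_fin_int_eq_add_mul [NeZero N] (r : ℤ) : ∃ (c : Fin N) (n : ℤ), r = c + n * N := by
  have hN : (0 : ℤ) < N := Nat.cast_pos.2 (NeZero.pos N)
  have hr := Int.emod_nonneg r hN.ne'
  refine ⟨⟨(r % N).toNat, ?_⟩, r / N, ?_⟩
  · have := Int.emod_lt_of_pos r hN
    omega
  · simp only [Int.toNat_of_nonneg hr, Int.emod_add_ediv_mul]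

theorem exists_mem_arc [NeZero N] {z : OnePoint ℂ} (h₀ : z ∈ disc 0) (h₁ : z ∈ disc 1) :
    ∃ c, z ∈ arc N c := by
  obtain ⟨u, rfl⟩ := exists_circle_of_mem_disc h₀ h₁
  obtain ⟨t, rfl⟩ := circlePoint_surjective (N := N) u
  obtain ⟨c, n, hn⟩ := exists_fin_int_eq_add_mul (N := N) (round t - 1)
  have hround : (round t : ℝ) = (c : ℕ) + 1 + n * N := by
    exact_mod_cast (by linarith : round t = (c : ℕ) + 1 + n * N)
  refine ⟨c, mem_arc_iff.2 ⟨t - n * N, ?_, ?_⟩⟩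
  · rw [sub_sub, add_comm, ← hround]
    exact abs_sub_round t
  · rw [circlePoint_eq_iff.2 ⟨n, (sub_add_cancel t (n * N)).symm⟩]

/- Two numbers of absolute value at most `1 / 2` that differ by a nonzero integer are `± 1 / 2`. -/
theorem mem_centres_of_mem_arc {c d : Fin N} (hcd : c ≠ d) {z : OnePoint ℂ}
    (hc : z ∈ arc N c) (hd : z ∈ arc N d) : z ∈ centres N := by
  have := c.neZero
  obtain ⟨t, ht, rfl⟩ := mem_arc_iff.1 hc
  obtain ⟨s, hs, hts⟩ := mem_arc_iff.1 hd
  rw [OnePoint.coe_eq_coe, Circle.coe_inj, circlePoint_eq_iff] at hts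
  obtain ⟨n, hn⟩ := hts
  have hdvd : ¬ (N : ℤ) ∣ d - c := fun h => hcd <| Fin.ext <|
    Nat.ModEq.eq_of_lt_of_lt ((Nat.modEq_iff_dvd).2 h) c.2 d.2
  obtain ⟨m, hm⟩ : ∃ m : ℤ, m = d - c + n * N := ⟨_, rfl⟩
  have hm0 : m ≠ 0 := fun h => hdvd ⟨-n, by linarith⟩
  have hmt : (m : ℝ) = (t - ((c : ℕ) + 1)) - (s - ((d : ℕ) + 1)) := by
    rw [hm, hn]
    push_cast
    ring
  rw [abs_le] at ht hs
  have hm_le : m ≤ 1 := by exact_mod_cast (by linarith : (m : ℝ) ≤ 1)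
  have hm_ge : -1 ≤ m := by exact_mod_cast (by linarith : (-1 : ℝ) ≤ m)
  suffices ∃ r : ℤ, t = r + 1 / 2 by
    obtain ⟨r, rfl⟩ := this
    exact ⟨_, rfl, circlePoint_int_add_half_pow r⟩
  obtain rfl | rfl : m = 1 ∨ m = -1 := by omega
  · exact ⟨(c : ℕ) + 1, by push_cast at hmt ⊢; linarith⟩
  · exact ⟨(c : ℕ), by push_cast at hmt ⊢; linarith⟩

/-- The complement of all arcs but the one of colour `c + 1`. Over it the surface is a disjoint
union of sheets, one for each white vertex. -/
def arcNhd (N : ℕ) (c : Fin N) : Set (OnePoint ℂ) := (⋃ d ∈ {d | d ≠ c}, arc N d)ᶜ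

theorem mem_arcNhd {c : Fin N} {z : OnePoint ℂ} :
    z ∈ arcNhd N c ↔ ∀ d, z ∈ arc N d → d = c := by
  simp only [arcNhd, Set.mem_compl_iff, Set.mem_iUnion, Set.mem_ofPred_eq, not_exists]
  exact forall_congr' fun d => ⟨fun h hz => by_contra fun hd => h hd hz, fun h hd hz => hd (h hz)⟩

theorem isOpen_arcNhd (c : Fin N) : IsOpen (arcNhd N c) :=
  (Set.Finite.isClosed_biUnion (Set.toFinite _) fun d _ => isClosed_arc d).isOpen_compl

theorem exists_mem_arcNhd [NeZero N] {z : OnePoint ℂ} (hz : z ∉ centres N) :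
    ∃ c, z ∈ arcNhd N c := by
  by_cases h : ∃ c, z ∈ arc N c
  · obtain ⟨c, hc⟩ := h
    exact ⟨c, mem_arcNhd.2 fun d hd => by_contra fun hne => hz (mem_centres_of_mem_arc hne hd hc)⟩
  · exact ⟨0, mem_arcNhd.2 fun d hd => (h ⟨d, hd⟩).elim⟩

theorem mem_arc_of_mem_arcNhd {c : Fin N} {z : OnePoint ℂ} (hz : z ∈ arcNhd N c)
    (h₀ : z ∈ disc 0) (h₁ : z ∈ disc 1) : z ∈ arc N c := by
  have := c.neZero
  obtain ⟨d, hd⟩ := exists_mem_arc (N := N) h₀ h₁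
  exact mem_arcNhd.1 hz d hd ▸ hd

variable (A : Chromotopology N)

theorem parity_eq_one {v : A.V} (h : A.parity v ≠ 0) : A.parity v = 1 :=
  (by decide : ∀ a : ZMod 2, a ≠ 0 → a = 1) _ h

theorem parity_edge_eq_one {c : Fin N} {v : A.V} (h : A.parity v = 0) :
    A.parity (A.edge c v) = 1 := by
  rw [A.parity_edge, h, zero_add]

theorem parity_edge_eq_zero {c : Fin N} {v : A.V} (h : A.parity v ≠ 0) :
    A.parity (A.edge c v) = 0 := by
  rw [A.parity_edge, A.parity_eq_one h]
  rfl

variable {A} in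
theorem White.ext {w w' : A.White} (h : w.1 = w'.1) : w = w' := Subtype.ext h

/-- The white end of the edge of colour `c + 1` at `v`. -/
def whiteEnd (c : Fin N) (v : A.V) : A.White :=
  if h : A.parity v = 0 then ⟨v, h⟩ else ⟨A.edge c v, A.parity_edge_eq_zero h⟩

theorem whiteEnd_of_white (c : Fin N) {v : A.V} (h : A.parity v = 0) :
    A.whiteEnd c v = ⟨v, h⟩ := dif_pos h

theorem whiteEnd_of_black (c : Fin N) {v : A.V} (h : A.parity v ≠ 0) :
    A.whiteEnd c v = ⟨A.edge c v, A.parity_edge_eq_zero h⟩ := dif_neg h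

theorem whiteEnd_coe (c : Fin N) (w : A.White) : A.whiteEnd c w.1 = w :=
  A.whiteEnd_of_white c w.2

theorem whiteEnd_edge (c : Fin N) (v : A.V) : A.whiteEnd c (A.edge c v) = A.whiteEnd c v := by
  by_cases h : A.parity v = 0
  · rw [A.whiteEnd_of_white c h, A.whiteEnd_of_black c (by rw [A.parity_edge_eq_one h]; decide)]
    exact White.ext (A.edge_edge c v)
  · rw [A.whiteEnd_of_black c h, A.whiteEnd_of_white c (A.parity_edge_eq_zero h)]

/-- The edges of colour `c + 1` are indexed by their white ends, so a vertex is given by an edge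
together with its own parity. -/
def whiteEndEquiv (c : Fin N) : A.V ≃ A.White × ZMod 2 where
  toFun v := (A.whiteEnd c v, A.parity v)
  invFun p := if p.2 = 0 then p.1.1 else A.edge c p.1.1
  left_inv v := by
    dsimp only
    split_ifs with h
    · rw [A.whiteEnd_of_white c h]
    · rw [A.whiteEnd_of_black c h, A.edge_edge]
  right_inv := by
    rintro ⟨w, b⟩
    dsimp only
    split_ifs with h
    · rw [A.whiteEnd_coe, w.2, h]
    · rw [A.whiteEnd_edge, A.whiteEnd_coe, A.parity_edge_eq_one w.2]
      exact Prod.ext rfl ((by decide : ∀ a : ZMod 2, a ≠ 0 → 1 = a) b h)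

/-- The end of parity `b` of the edge of colour `c + 1` at the white vertex `w`. -/
def edgeEnd (c : Fin N) (w : A.White) (b : ZMod 2) : A.V := (A.whiteEndEquiv c).symm (w, b)

theorem edgeEnd_whiteEnd (c : Fin N) (v : A.V) : A.edgeEnd c (A.whiteEnd c v) (A.parity v) = v :=
  (A.whiteEndEquiv c).symm_apply_apply v

theorem whiteEnd_edgeEnd (c : Fin N) (w : A.White) (b : ZMod 2) :
    A.whiteEnd c (A.edgeEnd c w b) = w :=
  congrArg Prod.fst ((A.whiteEndEquiv c).apply_symm_apply (w, b))

theorem parity_edgeEnd (c : Fin N) (w : A.White) (b : ZMod 2) :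
    A.parity (A.edgeEnd c w b) = b :=
  congrArg Prod.snd ((A.whiteEndEquiv c).apply_symm_apply (w, b))

theorem mem_disc_parity_edgeEnd {c : Fin N} {w : A.White} {b : ZMod 2} {z : OnePoint ℂ}
    (hz : z ∈ disc b) : z ∈ disc (A.parity (A.edgeEnd c w b)) := by
  rwa [A.parity_edgeEnd]

/-- The point over `z` of the disc around `v`. -/
def discPoint (v : A.V) (z : OnePoint ℂ) (hz : z ∈ disc (A.parity v)) : A.Surface :=
  Quot.mk _ ⟨v, z, hz⟩

theorem exists_discPoint_eq (x : A.Surface) : ∃ v z hz, A.discPoint v z hz = x := by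
  obtain ⟨⟨v, z, hz⟩, rfl⟩ := Quot.exists_rep x
  exact ⟨v, z, hz, rfl⟩

theorem discPoint_eq_discPoint_edge {c : Fin N} {v : A.V} {z : OnePoint ℂ} (hz : z ∈ arc N c) :
    A.discPoint v z (arc_subset_disc c _ hz) =
      A.discPoint (A.edge c v) z (arc_subset_disc c _ hz) :=
  Quot.sound ⟨c, rfl, rfl, hz⟩

theorem continuous_discPoint (v : A.V) {X : Type*} [TopologicalSpace X] {f : X → OnePoint ℂ}
    (hf : Continuous f) (hmem : ∀ x, f x ∈ disc (A.parity v)) :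
    Continuous fun x => A.discPoint v (f x) (hmem x) :=
  continuous_quot_mk.comp (continuous_sigmaMk.comp (hf.subtype_mk hmem))

theorem continuous_toSphere : Continuous A.toSphere :=
  continuous_quot_lift _ (continuous_sigma fun _ => continuous_subtype_val)

open Classical in
/-- The point over `z` in the discs at the two ends of the edge of colour `c + 1` at `w`. -/
def sheet (c : Fin N) (w : A.White) (z : OnePoint ℂ) : A.Surface :=
  if h : z ∈ disc 0 then A.discPoint (A.edgeEnd c w 0) z (A.mem_disc_parity_edgeEnd h)
  else A.discPoint (A.edgeEnd c w 1) z <| A.mem_disc_parity_edgeEnd <|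
    (mem_disc_zero_or_one z).resolve_left h

theorem toSphere_sheet (c : Fin N) (w : A.White) (z : OnePoint ℂ) :
    A.toSphere (A.sheet c w z) = z := by
  unfold sheet
  split_ifs <;> rfl

theorem sheet_eq_discPoint {c : Fin N} {w : A.White} {z : OnePoint ℂ} (hz : z ∈ arcNhd N c)
    {b : ZMod 2} (hb : z ∈ disc b) :
    A.sheet c w z = A.discPoint (A.edgeEnd c w b) z (A.mem_disc_parity_edgeEnd hb) := by
  unfold sheet
  fin_cases b
  · exact dif_pos hb
  · split_ifs with h₀
    · exact A.discPoint_eq_discPoint_edge (mem_arc_of_mem_arcNhd hz h₀ hb)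
    · rfl

theorem discPoint_eq_sheet {c : Fin N} {v : A.V} {z : OnePoint ℂ} (hz : z ∈ disc (A.parity v))
    (hc : z ∈ arcNhd N c) : A.discPoint v z hz = A.sheet c (A.whiteEnd c v) z := by
  rw [A.sheet_eq_discPoint hc hz]
  congr 1
  exact (A.edgeEnd_whiteEnd c v).symm

theorem sheet_surjective {c : Fin N} {x : A.Surface} (hx : A.toSphere x ∈ arcNhd N c) :
    ∃ w, A.sheet c w (A.toSphere x) = x := by
  obtain ⟨v, z, hz, rfl⟩ := A.exists_discPoint_eq x
  exact ⟨_, (A.discPoint_eq_sheet hz hx).symm⟩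

theorem continuous_sheet (c : Fin N) (w : A.White) :
    Continuous fun z : arcNhd N c => A.sheet c w z := by
  refine (locallyFinite_of_finite fun b : ZMod 2 =>
    (Subtype.val : arcNhd N c → OnePoint ℂ) ⁻¹' disc b).continuous ?_
    (fun b => (isClosed_disc b).preimage continuous_subtype_val) fun b => ?_
  · refine Set.eq_univ_of_forall fun z => ?_
    rcases mem_disc_zero_or_one z.1 with h | h
    exacts [Set.mem_iUnion.2 ⟨0, h⟩, Set.mem_iUnion.2 ⟨1, h⟩]
  · rw [continuousOn_iff_continuous_domRestrict]
    refine (A.continuous_discPoint (A.edgeEnd c w b) (X := Subtype.val ⁻¹' disc b)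
      (continuous_subtype_val.comp continuous_subtype_val)
      fun z => A.mem_disc_parity_edgeEnd z.2).congr fun z => ?_
    exact (A.sheet_eq_discPoint z.1.2 z.2).symm

open Classical in
/-- The white vertex which labels the sheet of a point over `arcNhd N c`, and `none` at all other
points. -/
def sheetLabel (c : Fin N) : A.Surface → Option A.White :=
  Quot.lift (fun p => if (p.2 : OnePoint ℂ) ∈ arcNhd N c then some (A.whiteEnd c p.1) else none)
  <| by
    rintro p q ⟨d, hedge, hz, hd⟩
    simp only [hz]
    split_ifs with h
    · obtain rfl := mem_arcNhd.1 h d hd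
      rw [hedge, whiteEnd_edge]
    · rfl

theorem sheetLabel_discPoint {c : Fin N} {v : A.V} {z : OnePoint ℂ} {hz : z ∈ disc (A.parity v)}
    {w : A.White} : A.sheetLabel c (A.discPoint v z hz) = some w ↔
      z ∈ arcNhd N c ∧ A.whiteEnd c v = w := by
  simp [sheetLabel, discPoint]

theorem sheetLabel_sheet {c : Fin N} (w : A.White) {z : OnePoint ℂ} (hz : z ∈ arcNhd N c) :
    A.sheetLabel c (A.sheet c w z) = some w := by
  rcases mem_disc_zero_or_one z with h | h <;>
    rw [A.sheet_eq_discPoint hz h, A.sheetLabel_discPoint] <;>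
    exact ⟨hz, A.whiteEnd_edgeEnd c w _⟩

theorem isOpen_sheetLabel (c : Fin N) (w : A.White) : IsOpen {x | A.sheetLabel c x = some w} := by
  rw [← isQuotientMap_quot_mk.isOpen_preimage, isOpen_sigma_iff]
  intro v
  have : Sigma.mk v ⁻¹' (Quot.mk A.Glue ⁻¹' {x | A.sheetLabel c x = some w}) =
      {z : disc (A.parity v) | z.1 ∈ arcNhd N c ∧ A.whiteEnd c v = w} :=
    Set.ext fun z => A.sheetLabel_discPoint (hz := z.2)
  rw [this]
  exact ((isOpen_arcNhd c).preimage continuous_subtype_val).and isOpen_const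

instance : TopologicalSpace A.White := ⊥

instance : DiscreteTopology A.White := ⟨rfl⟩

theorem bijective_sheet (c : Fin N) : Function.Bijective fun p : arcNhd N c × A.White =>
    (⟨A.sheet c p.2 p.1, by rw [Set.mem_preimage, A.toSphere_sheet]; exact p.1.2⟩ :
      A.toSphere ⁻¹' arcNhd N c) := by
  constructor
  · rintro ⟨z, w⟩ ⟨z', w'⟩ h
    have h' : A.sheet c w z = A.sheet c w' z' := congrArg Subtype.val h
    have hz := congrArg A.toSphere h'
    have hw := congrArg (A.sheetLabel c) h'
    rw [A.toSphere_sheet, A.toSphere_sheet] at hz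
    rw [A.sheetLabel_sheet w z.2, A.sheetLabel_sheet w' z'.2] at hw
    exact Prod.ext (Subtype.ext hz) (Option.some.inj hw)
  · rintro ⟨x, hx⟩
    obtain ⟨w, hw⟩ := A.sheet_surjective hx
    exact ⟨(⟨_, hx⟩, w), Subtype.ext hw⟩

/-- The part of the surface over `arcNhd N c` is the disjoint union of its sheets. -/
def sheetEquiv (c : Fin N) : arcNhd N c × A.White ≃ A.toSphere ⁻¹' arcNhd N c :=
  Equiv.ofBijective _ (A.bijective_sheet c)

theorem toSphere_sheetEquiv (c : Fin N) (p : arcNhd N c × A.White) :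
    A.toSphere (A.sheetEquiv c p) = p.1 := A.toSphere_sheet c p.2 p.1

theorem sheetLabel_sheetEquiv (c : Fin N) (p : arcNhd N c × A.White) :
    A.sheetLabel c (A.sheetEquiv c p) = some p.2 := A.sheetLabel_sheet p.2 p.1.2

theorem coe_sheetEquiv_symm_fst (c : Fin N) (x : A.toSphere ⁻¹' arcNhd N c) :
    (((A.sheetEquiv c).symm x).1 : OnePoint ℂ) = A.toSphere x := by
  rw [← A.toSphere_sheetEquiv, Equiv.apply_symm_apply]

theorem some_sheetEquiv_symm_snd (c : Fin N) (x : A.toSphere ⁻¹' arcNhd N c) :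
    some ((A.sheetEquiv c).symm x).2 = A.sheetLabel c x := by
  rw [← A.sheetLabel_sheetEquiv, Equiv.apply_symm_apply]

theorem continuous_sheetEquiv (c : Fin N) : Continuous (A.sheetEquiv c) :=
  continuous_prod_of_discrete_right.2 fun w => (A.continuous_sheet c w).subtype_mk _

theorem continuous_sheetEquiv_symm (c : Fin N) : Continuous (A.sheetEquiv c).symm := by
  refine Continuous.prodMk (f := fun x => ((A.sheetEquiv c).symm x).1)
    (g := fun x => ((A.sheetEquiv c).symm x).2) ?_ ?_
  · exact continuous_induced_rng.2 ((A.continuous_toSphere.comp continuous_subtype_val).congr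
      fun x => (A.coe_sheetEquiv_symm_fst c x).symm)
  · refine continuous_discrete_rng.2 fun w => ?_
    convert (A.isOpen_sheetLabel c w).preimage
      (continuous_subtype_val (p := (· ∈ A.toSphere ⁻¹' arcNhd N c))) using 1
    ext x
    rw [Set.mem_preimage, Set.mem_preimage, Set.mem_ofPred_eq, ← A.some_sheetEquiv_symm_snd,
      Option.some_inj, Set.mem_singleton_iff]

theorem isCoveringMap_proj [NeZero N] : IsCoveringMap A.proj := by
  refine IsCoveringMapOn.isCoveringMap_restrictPreimage _ fun z hz => ?_
  obtain ⟨c, hc⟩ := exists_mem_arcNhd hz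
  exact IsEvenlyCovered.to_isEvenlyCovered_preimage (I := A.White)
    ⟨inferInstance, arcNhd N c, hc, isOpen_arcNhd c,
      (isOpen_arcNhd c).preimage A.continuous_toSphere,
      ⟨(A.sheetEquiv c).symm, A.continuous_sheetEquiv_symm c, A.continuous_sheetEquiv c⟩,
      A.coe_sheetEquiv_symm_fst c⟩

end Chromotopology

theorem monodromy_map_of_covering_map {E E' X : Type*} [TopologicalSpace E] [TopologicalSpace E']
    [TopologicalSpace X] {p : E → X} {p' : E' → X} (cov : IsCoveringMap p)
    (cov' : IsCoveringMap p') (g : C(E, E')) (hg : ∀ e, p' (g e) = p e) {x y : X}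
    (γ : Path.Homotopic.Quotient x y) (e : p ⁻¹' {x}) :
    (cov'.monodromy γ ⟨g e, (hg e).trans e.2⟩ : E') = g (cov.monodromy γ e) := by
  obtain ⟨γ⟩ := γ
  have h₀ : γ 0 = p e := γ.source.trans e.2.symm
  have : g.comp (cov.liftPath γ e h₀) = cov'.liftPath γ (g e) (h₀.trans (hg e).symm) := by
    rw [cov'.eq_liftPath_iff']
    refine ⟨?_, congrArg g (cov.liftPath_zero _ _ _)⟩
    rw [← cov.liftPath_lifts γ e h₀]
    exact funext fun t => hg _
  exact (DFunLike.congr_fun this 1).symm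

section TransitiveAction

variable {M α : Type*} [Group M] [MulAction M α] [FaithfulSMul M α]

theorem eq_of_smul_eq_of_mem_centralizer {G : Subgroup M} [MulAction.IsPretransitive G α]
    {g h : M} (hg : g ∈ Subgroup.centralizer (G : Set M))
    (hh : h ∈ Subgroup.centralizer (G : Set M)) {a : α} (hgh : g • a = h • a) : g = h := by
  refine eq_of_smul_eq_smul (α := α) fun b => ?_
  obtain ⟨k, rfl⟩ := MulAction.exists_smul_eq G a b
  rw [Subgroup.smul_def, smul_smul, smul_smul, ← hg k k.2, ← hh k k.2, mul_smul, mul_smul, hgh]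

theorem closure_eq_of_forall_exists_smul_eq {S : Set M} {H : Subgroup M}
    [MulAction.IsPretransitive (Subgroup.closure S) α] (hS : S ⊆ Subgroup.centralizer S)
    (hH : H ≤ Subgroup.centralizer S) (horbit : ∀ s ∈ S, ∀ a : α, ∃ h ∈ H, h • a = s • a) :
    Subgroup.closure S = H := by
  have hle : Subgroup.closure S ≤ Subgroup.centralizer S := (Subgroup.closure_le _).2 hS
  rw [← Subgroup.centralizer_closure] at hH hle
  rcases isEmpty_or_nonempty α with hα | ⟨⟨a⟩⟩
  · have hone (g : M) : g = 1 := eq_of_smul_eq_smul (α := α) fun a => hα.elim a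
    exact le_antisymm (fun g _ => hone g ▸ one_mem H) fun g _ => hone g ▸ one_mem _
  refine le_antisymm ((Subgroup.closure_le _).2 fun s hs => ?_) fun h hh => ?_
  · obtain ⟨h, hh, hsa⟩ := horbit s hs a
    rwa [SetLike.mem_coe, eq_of_smul_eq_of_mem_centralizer
      (hle (Subgroup.subset_closure hs)) (hH hh) hsa.symm]
  · obtain ⟨⟨g, hg⟩, hga⟩ := MulAction.exists_smul_eq (Subgroup.closure S) a (h • a)
    rwa [eq_of_smul_eq_of_mem_centralizer (hH hh) (hle hg) hga.symm]

end TransitiveAction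

namespace Chromotopology

variable {N : ℕ} {A B : Chromotopology N}

namespace Iso

variable (e : A.Iso B)

/-- The bijection of the white vertices induced by an isomorphism. -/
def whiteEquiv : A.White ≃ B.White :=
  e.toEquiv.subtypeEquiv fun v => by rw [e.map_parity]

theorem mem_disc_parity {v : A.V} {z : OnePoint ℂ} (hz : z ∈ disc (A.parity v)) :
    z ∈ disc (B.parity (e.toEquiv v)) := by
  rwa [e.map_parity]

/-- The map of the surfaces over `B_N` induced by an isomorphism. -/
def surfaceMap : A.Surface → B.Surface :=
  Quot.lift (fun p => B.discPoint (e.toEquiv p.1) p.2 (e.mem_disc_parity p.2.2)) <| by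
    rintro ⟨v, z, hz⟩ ⟨v', z', hz'⟩ ⟨c, rfl : v' = A.edge c v, rfl : z' = z, harc⟩
    exact Quot.sound ⟨c, e.map_edge c v, rfl, harc⟩

theorem continuous_surfaceMap : Continuous e.surfaceMap :=
  continuous_quot_lift _ <| continuous_sigma fun v =>
    B.continuous_discPoint (e.toEquiv v) (f := ((↑) : disc (A.parity v) → OnePoint ℂ))
      continuous_subtype_val fun z => e.mem_disc_parity z.2

theorem toSphere_surfaceMap (x : A.Surface) : B.toSphere (e.surfaceMap x) = A.toSphere x := by
  obtain ⟨v, z, hz, rfl⟩ := A.exists_discPoint_eq x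
  rfl

/-- The map of coverings of the complement of the face centres induced by an isomorphism. -/
def coveringMap : C(A.toSphere ⁻¹' (centres N)ᶜ, B.toSphere ⁻¹' (centres N)ᶜ) where
  toFun := Set.MapsTo.restrict e.surfaceMap _ _ fun x hx => by
    rwa [Set.mem_preimage, e.toSphere_surfaceMap]
  continuous_toFun := e.continuous_surfaceMap.restrict _

theorem proj_coveringMap (x : A.toSphere ⁻¹' (centres N)ᶜ) :
    B.proj (e.coveringMap x) = A.proj x :=
  Subtype.ext (e.toSphere_surfaceMap x)

end Iso

variable (A)

theorem point_mem (w : A.White) : A.point w ∈ A.toSphere ⁻¹' (centres N)ᶜ :=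
  zero_mem_compl_centres N

theorem zero_mem_disc_zero : ((0 : ℂ) : OnePoint ℂ) ∈ disc 0 :=
  coe_mem_disc_zero.2 (by simp)

theorem zero_mem_arcNhd (c : Fin N) : ((0 : ℂ) : OnePoint ℂ) ∈ arcNhd N c := by
  refine mem_arcNhd.2 fun d hd => ?_
  have := coe_mem_disc_one.1 (arc_subset_disc d 1 hd)
  norm_num at this

theorem sheet_zero (c : Fin N) (w : A.White) :
    A.sheet c w ((0 : ℂ) : OnePoint ℂ) = A.point w :=
  A.sheet_eq_discPoint (zero_mem_arcNhd c) zero_mem_disc_zero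

section Monodromy

variable [NeZero N]

/-- The fibre over the white vertex of `B_N` consists of the white vertices. -/
def fiberEquiv : A.White ≃ (A.proj ⁻¹' {base N} : Set _) :=
  Equiv.ofBijective (fun w => ⟨⟨A.point w, A.point_mem w⟩, rfl⟩) <| by
    constructor
    · intro w w' h
      have hpoint : A.point w = A.point w' := congrArg (fun x => (x.1 : A.Surface)) h
      rw [← A.sheet_zero 0, ← A.sheet_zero 0] at hpoint
      have hlabel := congrArg (A.sheetLabel 0) hpoint
      rw [sheetLabel_sheet _ _ (zero_mem_arcNhd _), sheetLabel_sheet _ _ (zero_mem_arcNhd _)]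
        at hlabel
      exact Option.some.inj hlabel
    · rintro ⟨⟨x, hx⟩, h⟩
      have hx0 : A.toSphere x = ((0 : ℂ) : OnePoint ℂ) := congrArg Subtype.val h
      obtain ⟨w, hw⟩ := A.sheet_surjective (c := 0) (x := x) (hx0 ▸ zero_mem_arcNhd _)
      rw [hx0, A.sheet_zero] at hw
      exact ⟨w, Subtype.ext (Subtype.ext hw)⟩

/-- The monodromy of a loop as a permutation of the white vertices. -/
def whiteMonodromy : FundamentalGroup _ (base N) →* Perm A.White :=
  (A.fiberEquiv.symm.permCongrHom : Perm _ →* Perm A.White).comp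
    (A.isCoveringMap_proj.monodromyPerm (base N))

theorem fiberEquiv_whiteMonodromy (γ : FundamentalGroup _ (base N)) (w : A.White) :
    A.fiberEquiv (A.whiteMonodromy γ w) = A.isCoveringMap_proj.monodromy γ (A.fiberEquiv w) :=
  A.fiberEquiv.apply_symm_apply _

theorem map_range_whiteMonodromy :
    A.whiteMonodromy.range.map (A.fiberEquiv.permCongrHom : Perm A.White →* Perm _) =
      (A.isCoveringMap_proj.monodromyPerm (base N)).range := by
  rw [whiteMonodromy, MonoidHom.range_comp, Subgroup.map_map]
  convert Subgroup.map_id _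
  ext σ x
  simp

variable {A} in
theorem Iso.whiteEquiv_whiteMonodromy (e : A.Iso B) (γ : FundamentalGroup _ (base N))
    (w : A.White) :
    e.whiteEquiv (A.whiteMonodromy γ w) = B.whiteMonodromy γ (e.whiteEquiv w) := by
  have hfiber (w : A.White) : (B.fiberEquiv (e.whiteEquiv w)).1 =
      e.coveringMap (A.fiberEquiv w) := rfl
  refine B.fiberEquiv.injective (Subtype.ext ?_)
  rw [hfiber, fiberEquiv_whiteMonodromy, fiberEquiv_whiteMonodromy]
  exact (monodromy_map_of_covering_map A.isCoveringMap_proj B.isCoveringMap_proj e.coveringMap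
    e.proj_coveringMap γ (A.fiberEquiv w)).symm

theorem exists_whiteMonodromy_eq {w w' : A.White}
    (h : JoinedIn (A.toSphere ⁻¹' (centres N)ᶜ) (A.point w) (A.point w')) :
    ∃ γ, A.whiteMonodromy γ w = w' := by
  have cov := A.isCoveringMap_proj
  let Γ : Path.Homotopic.Quotient (A.fiberEquiv w).1 (A.fiberEquiv w').1 :=
    .mk ((joinedIn_iff_joined (A.point_mem w) (A.point_mem w')).1 h).some
  refine ⟨(Γ.map ⟨A.proj, cov.continuous⟩).cast (A.fiberEquiv w).2.symm
    (A.fiberEquiv w').2.symm, A.fiberEquiv.injective ?_⟩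
  rw [A.fiberEquiv_whiteMonodromy]
  exact cov.monodromy_eq_of_map_eq Γ ((Path.Homotopic.Quotient.cast_cast _ _ _ _ _).trans
    (Path.Homotopic.Quotient.cast_rfl_rfl _)).symm

end Monodromy

section Paths

theorem smul_pow_ne_neg_one {u : ℂ} (hu : ‖u‖ = 1) (huN : u ^ N ≠ -1) [NeZero N] {r : ℝ}
    (hr : 0 ≤ r) : (r • u) ^ N ≠ -1 := by
  intro h
  have hnorm : ‖r • u‖ ^ N = 1 := by rw [← norm_pow, h, norm_neg, norm_one]
  rw [norm_smul, hu, mul_one, Real.norm_of_nonneg hr,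
    pow_eq_one_iff_of_nonneg hr (NeZero.ne N)] at hnorm
  rw [hnorm, one_smul] at h
  exact huN h

theorem joinedIn_zero_of_norm_eq_one [NeZero N] {u : ℂ} (hu : ‖u‖ = 1) (huN : u ^ N ≠ -1) :
    JoinedIn {x : ℂ | ‖x‖ ≤ 1 ∧ x ^ N ≠ -1} 0 u := by
  refine JoinedIn.of_segment_subset ?_
  rw [segment_eq_image']
  rintro _ ⟨r, ⟨hr₀, hr₁⟩, rfl⟩
  simp only [zero_add, sub_zero]
  refine ⟨?_, smul_pow_ne_neg_one hu huN hr₀⟩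
  rwa [norm_smul, hu, mul_one, Real.norm_of_nonneg hr₀]

theorem joinedIn_two_smul_of_norm_eq_one [NeZero N] {u : ℂ} (hu : ‖u‖ = 1) (huN : u ^ N ≠ -1) :
    JoinedIn {x : ℂ | 1 ≤ ‖x‖ ∧ x ^ N ≠ -1} u ((2 : ℝ) • u) := by
  refine JoinedIn.of_segment_subset ?_
  rw [segment_eq_image']
  rintro _ ⟨r, ⟨hr, -⟩, rfl⟩
  have hline : u + r • ((2 : ℝ) • u - u) = (1 + r) • u := by module
  have hr' : 0 ≤ 1 + r := by positivity
  simp only [hline]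
  refine ⟨?_, smul_pow_ne_neg_one hu huN hr'⟩
  rwa [norm_smul, hu, mul_one, Real.norm_of_nonneg hr', le_add_iff_nonneg_right]

theorem joinedIn_of_norm_eq_one [NeZero N] {u v : ℂ} (hu : ‖u‖ = 1) (huN : u ^ N ≠ -1)
    (hv : ‖v‖ = 1) (hvN : v ^ N ≠ -1) : JoinedIn {x : ℂ | 1 ≤ ‖x‖ ∧ x ^ N ≠ -1} u v := by
  have hsphere : Metric.sphere (0 : ℂ) 2 ⊆ {x | 1 ≤ ‖x‖ ∧ x ^ N ≠ -1} := by
    intro x hx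
    rw [mem_sphere_zero_iff_norm] at hx
    refine ⟨by rw [hx]; norm_num, fun h => ?_⟩
    have hpow : ‖x‖ ^ N = 1 := by rw [← norm_pow, h, norm_neg, norm_one]
    rw [pow_eq_one_iff_of_nonneg (norm_nonneg x) (NeZero.ne N), hx] at hpow
    norm_num at hpow
  have hmem {w : ℂ} (hw : ‖w‖ = 1) : (2 : ℝ) • w ∈ Metric.sphere (0 : ℂ) 2 := by
    rw [mem_sphere_zero_iff_norm, norm_smul, hw]
    norm_num
  have hrank : 1 < Module.rank ℝ ℂ := by rw [Complex.rank_real_complex]; norm_num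
  exact (joinedIn_two_smul_of_norm_eq_one hu huN).trans <|
    (((isPathConnected_sphere hrank 0 zero_le_two).joinedIn _ (hmem hu) _ (hmem hv)).mono
      hsphere).trans (joinedIn_two_smul_of_norm_eq_one hv hvN).symm

theorem joinedIn_discPoint {v : A.V} {x y : ℂ} (hx : (x : OnePoint ℂ) ∈ disc (A.parity v))
    (hy : (y : OnePoint ℂ) ∈ disc (A.parity v))
    (h : JoinedIn {z : ℂ | (z : OnePoint ℂ) ∈ disc (A.parity v) ∧ z ^ N ≠ -1} x y) :
    JoinedIn (A.toSphere ⁻¹' (centres N)ᶜ) (A.discPoint v x hx) (A.discPoint v y hy) := by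
  obtain ⟨γ, hγ⟩ := h
  refine ⟨⟨⟨_, A.continuous_discPoint v (OnePoint.continuous_coe.comp γ.continuous)
    fun t => (hγ t).1⟩, by simp, by simp⟩, ?_⟩
  rintro t ⟨z, hz, hzN⟩
  exact (hγ t).2 (OnePoint.coe_injective hz ▸ hzN)

/-- The midpoint of the edge of colour `c + 1` at `v`. -/
def midpoint (c : Fin N) (v : A.V) : A.Surface :=
  A.discPoint v (circlePoint N ((c + 1 : ℕ) : ℝ) : ℂ) (circle_mem_disc _ _)

theorem midpoint_edge (c : Fin N) (v : A.V) : A.midpoint c (A.edge c v) = A.midpoint c v :=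
  (A.discPoint_eq_discPoint_edge (mem_arc_iff.2 ⟨_, by norm_num, rfl⟩)).symm

theorem circlePoint_natCast_pow_ne [NeZero N] (n : ℕ) : (circlePoint N n : ℂ) ^ N ≠ -1 := by
  rw [circlePoint_natCast_pow]
  norm_num

theorem joinedIn_point_midpoint (c : Fin N) (w : A.White) :
    JoinedIn (A.toSphere ⁻¹' (centres N)ᶜ) (A.point w) (A.midpoint c w.1) := by
  have := c.neZero
  refine A.joinedIn_discPoint (v := w.1) (w.2.symm ▸ zero_mem_disc_zero) _ ?_
  simp only [w.2, coe_mem_disc_zero]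
  exact joinedIn_zero_of_norm_eq_one (Circle.norm_coe _) (circlePoint_natCast_pow_ne _)

theorem joinedIn_midpoint_midpoint (c d : Fin N) {v : A.V} (hv : A.parity v = 1) :
    JoinedIn (A.toSphere ⁻¹' (centres N)ᶜ) (A.midpoint c v) (A.midpoint d v) := by
  have := c.neZero
  refine A.joinedIn_discPoint _ _ ?_
  simp only [hv, coe_mem_disc_one]
  exact joinedIn_of_norm_eq_one (Circle.norm_coe _) (circlePoint_natCast_pow_ne _)
    (Circle.norm_coe _) (circlePoint_natCast_pow_ne _)

theorem joinedIn_point_rho (c : Fin N) (w : A.White) :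
    JoinedIn (A.toSphere ⁻¹' (centres N)ᶜ) (A.point w) (A.point (A.rho c w)) := by
  have hc := A.joinedIn_point_midpoint c w
  have hd := A.joinedIn_point_midpoint (finRotate N c) (A.rho c w)
  have hblack := A.joinedIn_midpoint_midpoint c (finRotate N c)
    (A.parity_edge_eq_one (c := c) w.2)
  rw [midpoint_edge] at hblack
  refine hc.trans (hblack.trans ?_)
  rw [← A.midpoint_edge]
  exact hd.symm

end Paths

section Faces

/-- Following the edges of the colours `c + 1` and `d + 1` is an automorphism. -/
def faceIso (c d : Fin N) : A.Iso A where
  toEquiv :=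
    { toFun v := A.edge d (A.edge c v)
      invFun v := A.edge c (A.edge d v)
      left_inv v := by simp only [A.edge_edge]
      right_inv v := by simp only [A.edge_edge] }
  map_edge b v := by rw [Equiv.coe_fn_mk, A.edge_comm c b, A.edge_comm d b]
  map_parity v := by
    rw [Equiv.coe_fn_mk, A.parity_edge, A.parity_edge, add_assoc, CharTwo.add_self_eq_zero,
      add_zero]

/-- Following the edges of the colours `c + 1` and `d + 1`, as a permutation of the white
vertices. -/
def face (c d : Fin N) : Perm A.White := (A.faceIso c d).whiteEquiv

theorem rho_eq_face (c : Fin N) : A.rho c = A.face c (finRotate N c) := Equiv.ext fun _ => rfl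

variable {A} in
theorem Iso.whiteEquiv_face (e : A.Iso B) (c d : Fin N) (w : A.White) :
    e.whiteEquiv (A.face c d w) = B.face c d (e.whiteEquiv w) :=
  White.ext ((e.map_edge d _).trans (congrArg _ (e.map_edge c _)))

theorem commute_rho (c d : Fin N) : Commute (A.rho c) (A.rho d) := by
  rw [rho_eq_face, rho_eq_face]
  exact Equiv.ext fun w => (A.faceIso _ _).whiteEquiv_face _ _ w

theorem commute_whiteMonodromy_rho [NeZero N] (γ : FundamentalGroup _ (base N)) (c : Fin N) :
    Commute (A.whiteMonodromy γ) (A.rho c) := by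
  rw [rho_eq_face]
  exact Equiv.ext fun w => ((A.faceIso _ _).whiteEquiv_whiteMonodromy γ w).symm

theorem face_comm (c d : Fin N) : A.face c d = A.face d c :=
  Equiv.ext fun _ => White.ext (A.edge_comm _ _ _)

theorem face_self (c : Fin N) : A.face c c = 1 :=
  Equiv.ext fun _ => White.ext (A.edge_edge _ _)

theorem face_mul_face (b c d : Fin N) : A.face b c * A.face c d = A.face b d := by
  rw [A.face_comm b c, A.face_comm c d, A.face_comm b d]
  exact Equiv.ext fun w => White.ext (congrArg (A.edge b) (A.edge_edge c _))

theorem whiteEnd_edge_eq_face (c d : Fin N) (v : A.V) :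
    A.whiteEnd c (A.edge d v) = A.face c d (A.whiteEnd c v) := by
  by_cases h : A.parity v = 0
  · rw [A.whiteEnd_of_white _ h, A.whiteEnd_of_black _ (by rw [A.parity_edge_eq_one h]; decide)]
    exact White.ext (A.edge_comm c d v)
  · rw [A.whiteEnd_of_black _ h, A.whiteEnd_of_white _ (A.parity_edge_eq_zero h)]
    exact White.ext (congrArg (A.edge d) (A.edge_edge c v)).symm

theorem finRotate_of_succ_lt {c : Fin N} (h : (c : ℕ) + 1 < N) :
    finRotate N c = ⟨c + 1, h⟩ := by
  obtain _ | n := N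
  · exact c.elim0
  · exact finRotate_of_lt (by lia)

theorem finRotate_of_succ_eq [NeZero N] {c : Fin N} (h : (c : ℕ) + 1 = N) :
    finRotate N c = 0 := by
  obtain _ | n := N
  · exact c.elim0
  · obtain rfl : c = Fin.last n := Fin.ext (by simpa using h)
    exact finRotate_last

theorem prod_rho_castLE {n : ℕ} (h : n < N) :
    ((List.finRange n).map fun c => A.rho (Fin.castLE h.le c)).prod =
      A.face ⟨0, n.zero_le.trans_lt h⟩ ⟨n, h⟩ := by
  induction n with
  | zero => exact (A.face_self _).symm
  | succ n ih =>
    rw [List.finRange_succ_last, List.map_append, List.prod_append, List.map_map,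
      List.map_singleton, List.prod_singleton, rho_eq_face,
      finRotate_of_succ_lt (by simpa using h)]
    exact (congrArg (· * _) (ih (n.lt_succ_self.trans h))).trans (A.face_mul_face _ _ _)

theorem rho_last_eq_prod {c : Fin N} (hc : (c : ℕ) + 1 = N) :
    A.rho c = ((List.finRange N).dropLast.map A.rho).prod := by
  have := c.neZero
  rw [rho_eq_face, finRotate_of_succ_eq hc, face_comm]
  obtain _ | n := N
  · exact c.elim0
  · rw [List.finRange_succ_last, List.dropLast_concat, List.map_map]
    obtain rfl : c = ⟨n, n.lt_succ_self⟩ := Fin.ext (by simpa using hc)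
    exact (A.prod_rho_castLE n.lt_succ_self).symm

end Faces

/-- The permutations `ρ_c` of all colours `c` but the last one. -/
def faceGenerators : Set (Perm A.White) := {σ | ∃ c : Fin N, (c : ℕ) + 1 < N ∧ σ = A.rho c}

theorem faceGenerators_subset_centralizer :
    A.faceGenerators ⊆ Subgroup.centralizer A.faceGenerators := by
  rintro _ ⟨c, -, rfl⟩ _ ⟨d, -, rfl⟩
  exact A.commute_rho d c

theorem range_whiteMonodromy_le_centralizer [NeZero N] :
    A.whiteMonodromy.range ≤ Subgroup.centralizer A.faceGenerators := by
  rintro _ ⟨γ, rfl⟩ _ ⟨c, -, rfl⟩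
  exact (A.commute_whiteMonodromy_rho γ c).symm

theorem face_zero_mem_closure [NeZero N] (c : Fin N) :
    A.face 0 c ∈ Subgroup.closure A.faceGenerators := by
  obtain ⟨n, hn⟩ := c
  change A.face ⟨0, _⟩ _ ∈ _
  rw [← A.prod_rho_castLE hn]
  refine Subgroup.list_prod_mem _ fun σ hσ => Subgroup.subset_closure ?_
  obtain ⟨c, -, rfl⟩ := List.mem_map.1 hσ
  exact ⟨_, (Nat.succ_le_of_lt c.2).trans_lt hn, rfl⟩

/-- Any two vertices are joined by a path. -/
def Connected : Prop := ∀ v v', Relation.ReflTransGen (fun a b => ∃ c, b = A.edge c a) v v'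

variable {A}

theorem Connected.isPretransitive_closure [NeZero N] (hA : A.Connected) :
    MulAction.IsPretransitive (Subgroup.closure A.faceGenerators) A.White := by
  have hpath (w : A.White) {v : A.V}
      (hv : Relation.ReflTransGen (fun a b => ∃ c, b = A.edge c a) w.1 v) :
      ∃ g ∈ Subgroup.closure A.faceGenerators, g w = A.whiteEnd 0 v := by
    induction hv with
    | refl => exact ⟨1, one_mem _, (A.whiteEnd_coe 0 w).symm⟩
    | tail _ hu ih =>
      obtain ⟨c, rfl⟩ := hu
      obtain ⟨g, hg, h⟩ := ih
      refine ⟨A.face 0 c * g, mul_mem (A.face_zero_mem_closure c) hg, ?_⟩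
      rw [Perm.mul_apply, h, whiteEnd_edge_eq_face]
  refine ⟨fun w w' => ?_⟩
  obtain ⟨g, hg, h⟩ := hpath w (hA w.1 w'.1)
  exact ⟨⟨g, hg⟩, h.trans (A.whiteEnd_coe 0 w')⟩

theorem Connected.monodromyGeneratedBy [NeZero N] (hA : A.Connected) :
    A.MonodromyGeneratedBy A.faceGenerators := by
  have := hA.isPretransitive_closure
  refine ⟨A.isCoveringMap_proj, A.fiberEquiv, fun _ => rfl, ?_⟩
  rw [← map_range_whiteMonodromy, closure_eq_of_forall_exists_smul_eq (α := A.White)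
    A.faceGenerators_subset_centralizer A.range_whiteMonodromy_le_centralizer]
  rintro _ ⟨c, -, rfl⟩ w
  obtain ⟨γ, hγ⟩ := A.exists_whiteMonodromy_eq (A.joinedIn_point_rho c w)
  exact ⟨_, ⟨γ, rfl⟩, hγ⟩

section Codes

variable {C : Submodule (ZMod 2) (Fin N → ZMod 2)}

theorem connected_ofCode (h : DoublyEven C) : (ofCode C h).Connected := by
  have hpath (x : Fin N → ZMod 2) (v : (Fin N → ZMod 2) ⧸ C) :
      Relation.ReflTransGen (fun a b => ∃ c, b = a + C.mkQ (Pi.single c 1)) v (v + C.mkQ x) := by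
    induction x using Pi.single_induction generalizing v with
    | zero => rw [map_zero, add_zero]
    | add x y hx hy =>
      rw [map_add, ← add_assoc]
      exact (hx v).trans (hy _)
    | single c a =>
      rcases (by decide : ∀ a : ZMod 2, a = 0 ∨ a = 1) a with rfl | rfl
      · rw [Pi.single_zero, map_zero, add_zero]
      · exact Relation.ReflTransGen.single ⟨c, rfl⟩
  intro (v : (Fin N → ZMod 2) ⧸ C) (v' : (Fin N → ZMod 2) ⧸ C)
  obtain ⟨x, hx⟩ := C.mkQ_surjective (v' - v)
  have hvv' := hpath x v
  rwa [hx, add_sub_cancel] at hvv'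

theorem _root_.DoublyEven.finrank_lt [NeZero N] (h : DoublyEven C) :
    Module.finrank (ZMod 2) C < N := by
  have hne : C ≠ ⊤ := by
    intro htop
    have hmem : (Pi.single 0 1 : Fin N → ZMod 2) ∈ C := htop ▸ Submodule.mem_top
    have hparity := LinearMap.mem_ker.1 (h.le_ker hmem)
    simp [weightParity] at hparity
  simpa using Submodule.finrank_lt hne

theorem _root_.DoublyEven.two_pow_sub_finrank [NeZero N] (h : DoublyEven C) :
    2 ^ (N - Module.finrank (ZMod 2) C) = 2 * 2 ^ (N - Module.finrank (ZMod 2) C - 1) := by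
  rw [← pow_succ', Nat.sub_add_cancel (Nat.sub_pos_of_lt h.finrank_lt)]

theorem _root_.DoublyEven.two_pow_add_sub_finrank_add [NeZero N] {N' : ℕ} [NeZero N']
    {C' : Submodule (ZMod 2) (Fin N' → ZMod 2)} (h : DoublyEven C) (h' : DoublyEven C') :
    2 ^ (N + N' - (Module.finrank (ZMod 2) C + Module.finrank (ZMod 2) C') - 1) =
      2 ^ (N' - Module.finrank (ZMod 2) C' - 1) * 2 * 2 ^ (N - Module.finrank (ZMod 2) C - 1) := by
  have := h.finrank_lt
  have := h'.finrank_lt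
  rw [← pow_succ, ← pow_add]
  congr 1
  omega

theorem natCard_V (A : Chromotopology N) [NeZero N] : Nat.card A.V = Nat.card A.White * 2 := by
  rw [Nat.card_congr (A.whiteEndEquiv 0), Nat.card_prod, Nat.card_zmod]

theorem natCard_white_ofCode [NeZero N] (h : DoublyEven C) :
    Nat.card (ofCode C h).White = 2 ^ (N - Module.finrank (ZMod 2) C - 1) := by
  have hV : Nat.card (ofCode C h).V = 2 ^ (N - Module.finrank (ZMod 2) C) := by
    refine (Module.natCard_eq_pow_finrank (K := ZMod 2) (V := (Fin N → ZMod 2) ⧸ C)).trans ?_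
    rw [Submodule.finrank_quotient, Module.finrank_fin_fun, Nat.card_zmod]
  rw [natCard_V, h.two_pow_sub_finrank, mul_comm] at hV
  exact Nat.eq_of_mul_eq_mul_left two_pos hV

theorem nonempty_labeling_ofCode [NeZero N] (h : DoublyEven C) :
    Nonempty ((ofCode C h).Labeling (2 ^ (N - Module.finrank (ZMod 2) C - 1))) := by
  have hcard := natCard_white_ofCode h
  have := Nat.finite_of_card_ne_zero (hcard.trans_ne (by positivity))
  refine Finite.card_eq.1 (hcard.trans ?_)
  rw [Nat.card_eq_fintype_card, Fintype.card_coe, Nat.card_Icc, Nat.add_sub_cancel]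

theorem hammingNorm_single_add_single {c d : Fin N} (hcd : c ≠ d) :
    hammingNorm (Pi.single c 1 + Pi.single d 1 : Fin N → ZMod 2) = 2 := by
  refine (congrArg Finset.card ?_).trans (Finset.card_pair hcd)
  ext i
  obtain rfl | hc := eq_or_ne i c
  · simp [hcd]
  · obtain rfl | hd := eq_or_ne i d <;> simp [*]

theorem rho_ofCode_ne (h : DoublyEven C) (hN : 2 ≤ N) (c : Fin N) (w : (ofCode C h).White) :
    (ofCode C h).rho c w ≠ w := by
  have hc : c ≠ finRotate N c :=
    (Perm.mem_support.1 (support_finRotate_of_le hN ▸ Finset.mem_univ c)).symm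
  intro hw
  let v : (Fin N → ZMod 2) ⧸ C := w.1
  have hv : v + C.mkQ (Pi.single c 1) + C.mkQ (Pi.single (finRotate N c) 1) = v :=
    congrArg Subtype.val hw
  rw [add_assoc, add_eq_left, ← map_add, Submodule.mkQ_apply, Submodule.Quotient.mk_eq_zero] at hv
  have hweight := h _ hv
  rw [hammingNorm_single_add_single hc] at hweight
  norm_num at hweight

end Codes

/-- The inverse of an isomorphism. -/
def Iso.symm {A B : Chromotopology N} (e : A.Iso B) : B.Iso A where
  toEquiv := e.toEquiv.symm
  map_edge c v := by rw [Equiv.symm_apply_eq, e.map_edge, Equiv.apply_symm_apply]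
  map_parity v := by rw [← e.map_parity, Equiv.apply_symm_apply]

section Tensor

variable {N₁ N₂ : ℕ} (A₁ : Chromotopology N₁) (A₂ : Chromotopology N₂)

theorem tensor_edge_castAdd (c : Fin N₁) (v : A₁.V × A₂.V) :
    (A₁.tensor A₂).edge (Fin.castAdd N₂ c) v = (A₁.edge c v.1, v.2) := by
  simp [tensor]

theorem tensor_edge_natAdd (c : Fin N₂) (v : A₁.V × A₂.V) :
    (A₁.tensor A₂).edge (Fin.natAdd N₁ c) v = (v.1, A₂.edge c v.2) := by
  simp [tensor]

variable {A₁ A₂} in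
theorem Connected.tensor (h₁ : A₁.Connected) (h₂ : A₂.Connected) :
    (A₁.tensor A₂).Connected := by
  rintro ⟨v₁, v₂⟩ ⟨u₁, u₂⟩
  refine Relation.ReflTransGen.trans (b := ((u₁, v₂) : A₁.V × A₂.V)) ?_ ?_
  · refine (h₁ v₁ u₁).lift (fun v => ((v, v₂) : A₁.V × A₂.V)) ?_
    rintro v _ ⟨c, rfl⟩
    exact ⟨Fin.castAdd N₂ c, (tensor_edge_castAdd A₁ A₂ c (v, v₂)).symm⟩
  · refine (h₂ v₂ u₂).lift (fun v => ((u₁, v) : A₁.V × A₂.V)) ?_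
    rintro v _ ⟨c, rfl⟩
    exact ⟨Fin.natAdd N₁ c, (tensor_edge_natAdd A₁ A₂ c (u₁, v)).symm⟩

end Tensor

section TensorCode

variable {N₁ N₂ : ℕ} (C₁ : Submodule (ZMod 2) (Fin N₁ → ZMod 2))
  (C₂ : Submodule (ZMod 2) (Fin N₂ → ZMod 2))

/-- The projection of the `(N₁ + N₂)`-cube to the product of two quotients of cubes; its kernel is
the direct sum of the two codes. -/
def tensorMap : (Fin (N₁ + N₂) → ZMod 2) →ₗ[ZMod 2]
    ((Fin N₁ → ZMod 2) ⧸ C₁) × ((Fin N₂ → ZMod 2) ⧸ C₂) :=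
  (C₁.mkQ ∘ₗ LinearMap.funLeft (ZMod 2) (ZMod 2) (Fin.castAdd N₂)).prod
    (C₂.mkQ ∘ₗ LinearMap.funLeft (ZMod 2) (ZMod 2) (Fin.natAdd N₁))

theorem tensorMap_append (x₁ : Fin N₁ → ZMod 2) (x₂ : Fin N₂ → ZMod 2) :
    tensorMap C₁ C₂ (Fin.append x₁ x₂) = (C₁.mkQ x₁, C₂.mkQ x₂) := by
  refine Prod.ext (congrArg C₁.mkQ ?_) (congrArg C₂.mkQ ?_) <;> ext i
  · exact Fin.append_left x₁ x₂ i
  · exact Fin.append_right x₁ x₂ i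

theorem tensorMap_surjective : Function.Surjective (tensorMap C₁ C₂) := by
  rintro ⟨v₁, v₂⟩
  obtain ⟨x₁, rfl⟩ := C₁.mkQ_surjective v₁
  obtain ⟨x₂, rfl⟩ := C₂.mkQ_surjective v₂
  exact ⟨_, tensorMap_append C₁ C₂ x₁ x₂⟩

theorem finrank_ker_tensorMap : Module.finrank (ZMod 2) (LinearMap.ker (tensorMap C₁ C₂)) =
    Module.finrank (ZMod 2) C₁ + Module.finrank (ZMod 2) C₂ := by
  have hker := LinearMap.finrank_range_add_finrank_ker (tensorMap C₁ C₂)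
  rw [LinearMap.range_eq_top.2 (tensorMap_surjective C₁ C₂), finrank_top, Module.finrank_prod,
    Module.finrank_fin_fun] at hker
  have h₁ := C₁.finrank_quotient_add_finrank
  have h₂ := C₂.finrank_quotient_add_finrank
  rw [Module.finrank_fin_fun] at h₁ h₂
  lia

theorem hammingNorm_append (x₁ : Fin N₁ → ZMod 2) (x₂ : Fin N₂ → ZMod 2) :
    hammingNorm (Fin.append x₁ x₂) = hammingNorm x₁ + hammingNorm x₂ := by
  simp only [hammingNorm, Finset.card_filter, Fin.sum_univ_add, Fin.append_left, Fin.append_right]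

theorem append_add_single_castAdd (x₁ : Fin N₁ → ZMod 2) (x₂ : Fin N₂ → ZMod 2) (c : Fin N₁) :
    Fin.append x₁ x₂ + Pi.single (Fin.castAdd N₂ c) 1 = Fin.append (x₁ + Pi.single c 1) x₂ := by
  ext i
  refine Fin.addCases (fun i => ?_) (fun i => ?_) i <;> simp [Pi.single_apply, Fin.ext_iff]
  lia

theorem append_add_single_natAdd (x₁ : Fin N₁ → ZMod 2) (x₂ : Fin N₂ → ZMod 2) (c : Fin N₂) :
    Fin.append x₁ x₂ + Pi.single (Fin.natAdd N₁ c) 1 = Fin.append x₁ (x₂ + Pi.single c 1) := by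
  ext i
  refine Fin.addCases (fun i => ?_) (fun i => ?_) i <;> simp [Pi.single_apply, Fin.ext_iff]
  lia

variable {C₁ C₂} (h₁ : DoublyEven C₁) (h₂ : DoublyEven C₂)

include h₁ h₂ in
theorem doublyEven_ker_tensorMap : DoublyEven (LinearMap.ker (tensorMap C₁ C₂)) := by
  intro x hx
  obtain ⟨x₁, x₂, rfl⟩ : ∃ x₁ x₂, x = Fin.append x₁ x₂ := ⟨_, _, Fin.append_castAdd_natAdd.symm⟩
  rw [LinearMap.mem_ker, tensorMap_append, Prod.mk_eq_zero, Submodule.mkQ_apply,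
    Submodule.mkQ_apply, Submodule.Quotient.mk_eq_zero, Submodule.Quotient.mk_eq_zero] at hx
  rw [hammingNorm_append]
  exact dvd_add (h₁ _ hx.1) (h₂ _ hx.2)

theorem tensorMap_add_single (c : Fin (N₁ + N₂)) (x : Fin (N₁ + N₂) → ZMod 2) :
    tensorMap C₁ C₂ (x + Pi.single c 1) =
      ((ofCode C₁ h₁).tensor (ofCode C₂ h₂)).edge c (tensorMap C₁ C₂ x) := by
  obtain ⟨x₁, x₂, rfl⟩ : ∃ x₁ x₂, x = Fin.append x₁ x₂ := ⟨_, _, Fin.append_castAdd_natAdd.symm⟩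
  refine Fin.addCases (fun c => ?_) (fun c => ?_) c
  · rw [append_add_single_castAdd, tensorMap_append, tensorMap_append, map_add]
    exact (tensor_edge_castAdd (ofCode C₁ h₁) (ofCode C₂ h₂) c (C₁.mkQ x₁, C₂.mkQ x₂)).symm
  · rw [append_add_single_natAdd, tensorMap_append, tensorMap_append, map_add]
    exact (tensor_edge_natAdd (ofCode C₁ h₁) (ofCode C₂ h₂) c (C₁.mkQ x₁, C₂.mkQ x₂)).symm

theorem parity_tensorMap (x : Fin (N₁ + N₂) → ZMod 2) :
    ((ofCode C₁ h₁).tensor (ofCode C₂ h₂)).parity (tensorMap C₁ C₂ x) =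
      weightParity (N₁ + N₂) x := by
  change weightParity _ _ + weightParity _ _ = weightParity _ x
  simp [weightParity, Fin.sum_univ_add, LinearMap.funLeft_apply]

/-- The quotient of the cube by the direct sum of two codes is the tensor product of the quotients
by the two codes. -/
def tensorIso :
    (ofCode _ (doublyEven_ker_tensorMap h₁ h₂)).Iso ((ofCode C₁ h₁).tensor (ofCode C₂ h₂)) where
  toEquiv := ((tensorMap C₁ C₂).quotKerEquivOfSurjective (tensorMap_surjective C₁ C₂)).toEquiv
  map_edge c v := by
    induction v using Submodule.Quotient.induction_on with
    | H x => exact tensorMap_add_single h₁ h₂ c x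
  map_parity v := by
    induction v using Submodule.Quotient.induction_on with
    | H x => exact parity_tensorMap h₁ h₂ x

end TensorCode

end Chromotopology

section TwoCycles

theorem nodup_flatMap_pair_iff {α : Type*} {L : List (α × α)} :
    (L.flatMap fun p => [p.1, p.2]).Nodup ↔
      (L.map Prod.fst).Nodup ∧ (L.map Prod.snd).Nodup ∧
        List.Disjoint (L.map Prod.fst) (L.map Prod.snd) := by
  rw [← List.nodup_append', List.map_eq_flatMap, List.map_eq_flatMap]
  exact (List.flatMap_append_perm L (fun p => [p.1]) fun p => [p.2]).nodup_iff.symm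

theorem forall_mem_flatMap_pair_iff {α : Type*} {L : List (α × α)} {P : α → Prop} :
    (∀ x ∈ L.flatMap fun p => [p.1, p.2], P x) ↔ ∀ p ∈ L, P p.1 ∧ P p.2 := by
  simp only [List.mem_flatMap, List.mem_pair]
  exact ⟨fun h p hp => ⟨h _ ⟨p, hp, .inl rfl⟩, h _ ⟨p, hp, .inr rfl⟩⟩,
    fun h x ⟨p, hp, hx⟩ => hx.elim (· ▸ (h p hp).1) (· ▸ (h p hp).2)⟩

theorem notMem_flatMap_pair_iff {α : Type*} {L : List (α × α)} {x : α} :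
    (x ∉ L.flatMap fun p => [p.1, p.2]) ↔ ∀ p ∈ L, x ≠ p.1 ∧ x ≠ p.2 := by
  rw [← forall_mem_flatMap_pair_iff]
  exact ⟨fun h y hy hxy => h (hxy ▸ hy), fun h hx => h x hx rfl⟩

section ProdSwap

variable {α : Type*} [DecidableEq α] {L : List (α × α)}

theorem prod_map_swap_apply_of_ne {x : α} (hx : ∀ p ∈ L, x ≠ p.1 ∧ x ≠ p.2) :
    (L.map fun p => swap p.1 p.2).prod x = x := by
  induction L with
  | nil => rfl
  | cons q L ih =>
    rw [List.forall_mem_cons] at hx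
    rw [List.map_cons, List.prod_cons, Perm.mul_apply, ih hx.2,
      swap_apply_of_ne_of_ne hx.1.1 hx.1.2]

theorem prod_map_swap_apply_of_mem (hL : (L.flatMap fun p => [p.1, p.2]).Nodup) {p : α × α}
    (hp : p ∈ L) :
    (L.map fun p => swap p.1 p.2).prod p.1 = p.2 ∧
      (L.map fun p => swap p.1 p.2).prod p.2 = p.1 := by
  induction L with
  | nil => cases hp
  | cons q L ih =>
    rw [List.flatMap_cons, List.nodup_append'] at hL
    obtain ⟨-, hL, hdisj⟩ := hL
    have hq₁ := notMem_flatMap_pair_iff.1 (hdisj (a := q.1) (by simp))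
    have hq₂ := notMem_flatMap_pair_iff.1 (hdisj (a := q.2) (by simp))
    rw [List.map_cons, List.prod_cons, Perm.mul_apply, Perm.mul_apply]
    rcases List.mem_cons.1 hp with rfl | hp
    · rw [prod_map_swap_apply_of_ne hq₁, prod_map_swap_apply_of_ne hq₂]
      exact ⟨swap_apply_left _ _, swap_apply_right _ _⟩
    · rw [(ih hL hp).1, (ih hL hp).2]
      exact ⟨swap_apply_of_ne_of_ne (hq₁ p hp).2.symm (hq₂ p hp).2.symm,
        swap_apply_of_ne_of_ne (hq₁ p hp).1.symm (hq₂ p hp).1.symm⟩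

theorem eq_prod_map_swap {σ : Perm α} (hL : (L.flatMap fun p => [p.1, p.2]).Nodup)
    (hσ : ∀ p ∈ L, σ p.1 = p.2 ∧ σ p.2 = p.1)
    (hfix : ∀ x, (∀ p ∈ L, x ≠ p.1 ∧ x ≠ p.2) → σ x = x) :
    σ = (L.map fun p => swap p.1 p.2).prod := by
  ext x
  by_cases hx : x ∈ L.flatMap fun p => [p.1, p.2]
  · refine forall_mem_flatMap_pair_iff (P := fun x => σ x = _) |>.2 (fun p hp => ?_) x hx
    rw [(hσ p hp).1, (hσ p hp).2]
    exact (prod_map_swap_apply_of_mem hL hp).imp Eq.symm Eq.symm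
  · rw [notMem_flatMap_pair_iff] at hx
    rw [hfix x hx, prod_map_swap_apply_of_ne hx]

end ProdSwap

variable {σ : Perm ℕ} {L : List (ℕ × ℕ)}

theorem exists_isTwoCycleDecomposition (hσ : Function.Involutive σ) {m : ℕ}
    (hm : ∀ x, σ x ≠ x → x ∈ Finset.Icc 1 m) : ∃ L, IsTwoCycleDecomposition σ L := by
  let S := (List.range' 1 m).filter fun x => x < σ x
  have hS {x : ℕ} : x ∈ S ↔ x < σ x := by
    simp only [S, List.mem_filter, List.mem_range'_1, decide_eq_true_eq, and_iff_right_iff_imp]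
    intro hx
    have := Finset.mem_Icc.1 (hm x hx.ne')
    lia
  have hnodup : S.Nodup := List.Nodup.filter _ List.nodup_range'
  have hL : ((S.map fun x => (x, σ x)).flatMap fun p => [p.1, p.2]).Nodup := by
    rw [nodup_flatMap_pair_iff, List.map_map, List.map_map]
    refine ⟨(List.map_id S).symm ▸ hnodup, hnodup.map σ.injective, ?_⟩
    simp only [List.Disjoint, List.mem_map, Function.comp_apply, hS]
    rintro _ ⟨x, hx, rfl⟩ ⟨y, hy, rfl⟩
    rw [hσ y] at hx
    exact hx.asymm hy
  refine ⟨_, hL, eq_prod_map_swap hL ?_ ?_⟩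
  · simp only [List.forall_mem_map]
    exact fun x _ => ⟨trivial, hσ x⟩
  · simp only [List.forall_mem_map, hS]
    intro x hx
    by_contra hne
    rcases lt_or_gt_of_ne hne with hlt | hlt
    · exact (hx (σ x) (by rwa [hσ x])).2 (hσ x).symm
    · exact (hx x hlt).1 rfl

namespace IsTwoCycleDecomposition

theorem apply_of_mem (h : IsTwoCycleDecomposition σ L) {p : ℕ × ℕ} (hp : p ∈ L) :
    σ p.1 = p.2 ∧ σ p.2 = p.1 := by
  rw [h.prod_eq]
  exact prod_map_swap_apply_of_mem h.nodup hp

theorem exists_mem (h : IsTwoCycleDecomposition σ L) {x : ℕ} (hx : σ x ≠ x) :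
    ∃ p ∈ L, x = p.1 ∨ x = p.2 := by
  by_contra! hcon
  exact hx (h.prod_eq ▸ prod_map_swap_apply_of_ne hcon)

theorem apply_ne_of_mem (h : IsTwoCycleDecomposition σ L) {p : ℕ × ℕ} (hp : p ∈ L) :
    σ p.1 ≠ p.1 ∧ σ p.2 ≠ p.2 := by
  have hdisj := (nodup_flatMap_pair_iff.1 h.nodup).2.2
  have hne : p.1 ≠ p.2 := fun heq =>
    hdisj (List.mem_map_of_mem hp) (heq ▸ List.mem_map_of_mem hp)
  rw [(h.apply_of_mem hp).1, (h.apply_of_mem hp).2]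
  exact ⟨hne.symm, hne⟩

end IsTwoCycleDecomposition

theorem mem_range'_product_iff {α : Type*} {n : ℕ} {L : List α} {q : ℕ × α} :
    q ∈ List.range' 1 n ×ˢ L ↔ q.1 ∈ Finset.Icc 1 n ∧ q.2 ∈ L := by
  rw [List.mem_product, List.mem_range'_1, Finset.mem_Icc, add_comm, Nat.lt_succ_iff]

theorem orderedProd_relabel (n : ℕ) (L : List (ℕ × ℕ)) (f g : ℕ → ℕ → ℕ) :
    (orderedProd n fun J => relabel L (f J) (g J)) =
      (((List.range' 1 n ×ˢ L).map fun q => (f q.1 q.2.1, g q.1 q.2.2)).map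
        fun p => swap p.1 p.2).prod := by
  change _ = ((((List.range' 1 n).flatMap fun J => L.map (Prod.mk J)).map _).map _).prod
  rw [orderedProd, List.map_map, List.map_flatMap, List.flatMap_def, List.prod_flatten,
    List.map_map]
  simp only [relabel, List.map_map, Function.comp_def]

namespace IsTwoCycleDecomposition

theorem nodup_product_map (hL : IsTwoCycleDecomposition σ L) {n : ℕ} {f : ℕ → ℕ → ℕ} {π : ℕ → ℕ}
    (hπ : Set.MapsTo π (Finset.Icc 1 n) (Finset.Icc 1 n))
    (hππ : Set.InjOn π (Finset.Icc 1 n))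
    (hf : Set.InjOn (Function.uncurry f) (Finset.Icc 1 n ×ˢ {i | σ i ≠ i})) :
    (((List.range' 1 n ×ˢ L).map fun q => (f q.1 q.2.1, f (π q.1) q.2.2)).flatMap
      fun p => [p.1, p.2]).Nodup := by
  obtain ⟨hfst, hsnd, hdisj⟩ := nodup_flatMap_pair_iff.1 hL.nodup
  have hnodup : (List.range' 1 n ×ˢ L).Nodup :=
    List.Nodup.product List.nodup_range' (hfst.of_map _)
  have hinj {J J' i i' : ℕ} (hJ : J ∈ Finset.Icc 1 n) (hJ' : J' ∈ Finset.Icc 1 n) (hi : σ i ≠ i)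
      (hi' : σ i' ≠ i') (h : f J i = f J' i') : J = J' ∧ i = i' :=
    Prod.ext_iff.1 (@hf (J, i) ⟨hJ, hi⟩ (J', i') ⟨hJ', hi'⟩ h)
  rw [nodup_flatMap_pair_iff, List.map_map, List.map_map]
  refine ⟨hnodup.map_on fun q hq q' hq' h => ?_, hnodup.map_on fun q hq q' hq' h => ?_, ?_⟩
  · obtain ⟨⟨hJ, hp⟩, hJ', hp'⟩ :=
      And.intro (mem_range'_product_iff.1 hq) (mem_range'_product_iff.1 hq')
    obtain ⟨h₁, h₂⟩ := hinj hJ hJ' (hL.apply_ne_of_mem hp).1 (hL.apply_ne_of_mem hp').1 h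
    exact Prod.ext h₁ (List.inj_on_of_nodup_map hfst hp hp' h₂)
  · obtain ⟨⟨hJ, hp⟩, hJ', hp'⟩ :=
      And.intro (mem_range'_product_iff.1 hq) (mem_range'_product_iff.1 hq')
    obtain ⟨h₁, h₂⟩ :=
      hinj (hπ hJ) (hπ hJ') (hL.apply_ne_of_mem hp).2 (hL.apply_ne_of_mem hp').2 h
    exact Prod.ext (hππ hJ hJ' h₁) (List.inj_on_of_nodup_map hsnd hp hp' h₂)
  · simp only [List.Disjoint, List.mem_map, Function.comp_apply]
    rintro _ ⟨q, hq, rfl⟩ ⟨q', hq', h⟩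
    obtain ⟨⟨hJ, hp⟩, hJ', hp'⟩ :=
      And.intro (mem_range'_product_iff.1 hq) (mem_range'_product_iff.1 hq')
    obtain ⟨-, h₂⟩ := hinj (hπ hJ') hJ (hL.apply_ne_of_mem hp').2 (hL.apply_ne_of_mem hp).1 h
    exact hdisj (List.mem_map_of_mem hp) (h₂ ▸ List.mem_map_of_mem hp')

theorem eq_orderedProd_relabel (hL : IsTwoCycleDecomposition σ L) {τ : Perm ℕ} {n : ℕ}
    {f : ℕ → ℕ → ℕ} {π : ℕ → ℕ}
    (hπ : Set.MapsTo π (Finset.Icc 1 n) (Finset.Icc 1 n))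
    (hππ : Set.LeftInvOn π π (Finset.Icc 1 n))
    (hf : Set.InjOn (Function.uncurry f) (Finset.Icc 1 n ×ˢ {i | σ i ≠ i}))
    (hτ : ∀ J ∈ Finset.Icc 1 n, ∀ i, σ i ≠ i → τ (f J i) = f (π J) (σ i))
    (hfix : ∀ x, (∀ J ∈ Finset.Icc 1 n, ∀ i, σ i ≠ i → x ≠ f J i) → τ x = x) :
    τ = orderedProd n fun J => relabel L (f J) (f (π J)) := by
  rw [orderedProd_relabel n L f fun J => f (π J)]
  refine eq_prod_map_swap (hL.nodup_product_map hπ hππ.injOn hf) ?_ ?_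
  · simp only [List.forall_mem_map, Prod.forall, mem_range'_product_iff]
    rintro J a b ⟨hJ, hp⟩
    obtain ⟨hab, hba⟩ := hL.apply_of_mem hp
    obtain ⟨ha, hb⟩ := hL.apply_ne_of_mem hp
    rw [hτ J hJ a ha, hτ _ (hπ hJ) b hb, hππ hJ, hab, hba]
    exact ⟨rfl, rfl⟩
  · simp only [List.forall_mem_map, Prod.forall, mem_range'_product_iff]
    refine fun x hx => hfix x ?_
    rintro J hJ i hi rfl
    obtain ⟨p, hp, rfl | rfl⟩ := hL.exists_mem hi
    · exact (hx J _ _ ⟨hJ, hp⟩).1 rfl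
    · exact (hx (π J) _ _ ⟨hπ hJ, hp⟩).2 (by rw [hππ hJ])

end IsTwoCycleDecomposition

end TwoCycles

section Blocks

/-- The position of the `i`-th element of the `a`-th block in a sequence of blocks of length `m`,
all counted from `1`. -/
def blockLabel (m a i : ℕ) : ℕ := (a - 1) * m + i

theorem blockLabel_mem {n m a i : ℕ} (ha : a ∈ Finset.Icc 1 n) (hi : i ∈ Finset.Icc 1 m) :
    blockLabel m a i ∈ Finset.Icc 1 (n * m) := by
  rw [Finset.mem_Icc] at *
  have := Nat.mul_le_mul_right m (show a - 1 + 1 ≤ n by omega)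
  rw [add_one_mul] at this
  rw [blockLabel]
  omega

theorem blockLabel_blockLabel (n m a : ℕ) {b : ℕ} (hb : 1 ≤ b) (i : ℕ) :
    blockLabel m (blockLabel n a b) i = blockLabel (n * m) a (blockLabel m b i) := by
  rw [blockLabel, blockLabel, blockLabel, blockLabel, Nat.add_sub_assoc hb]
  ring

/-- `blockLabel` as a numbering of the pairs of a block and an element in lexicographic order. -/
def blockLabelEquiv (n m : ℕ) :
    Finset.Icc 1 n × Finset.Icc 1 m ≃ Finset.Icc 1 (n * m) where
  toFun p := ⟨blockLabel m p.1 p.2, blockLabel_mem p.1.2 p.2.2⟩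
  invFun x :=
    have hx := Finset.mem_Icc.1 x.2
    have hm : 0 < m := Nat.pos_of_mul_pos_left (hx.1.trans hx.2)
    (⟨(x - 1) / m + 1, Finset.mem_Icc.2 ⟨Nat.le_add_left 1 _,
        (Nat.div_lt_iff_lt_mul hm).2 (by omega)⟩⟩,
      ⟨(x - 1) % m + 1, Finset.mem_Icc.2 ⟨Nat.le_add_left 1 _, Nat.mod_lt _ hm⟩⟩)
  left_inv := by
    rintro ⟨⟨a, ha⟩, i, hi⟩
    rw [Finset.mem_Icc] at ha hi
    have hx : blockLabel m a i - 1 = i - 1 + m * (a - 1) := by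
      rw [blockLabel, mul_comm]
      omega
    simp only [hx, Prod.mk.injEq, Subtype.mk.injEq]
    rw [Nat.add_mul_div_left _ _ (by omega), Nat.add_mul_mod_self_left,
      Nat.div_eq_of_lt (by omega), Nat.mod_eq_of_lt (by omega)]
    omega
  right_inv := by
    rintro ⟨x, hx⟩
    rw [Finset.mem_Icc] at hx
    refine Subtype.ext ?_
    simp only [blockLabel, Nat.add_sub_cancel, ← add_assoc, Nat.div_add_mod']
    omega

theorem bijOn_blockLabel (n m : ℕ) : Set.BijOn (Function.uncurry (blockLabel m))
    (Finset.Icc 1 n ×ˢ Finset.Icc 1 m) (Finset.Icc 1 (n * m)) := by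
  refine ⟨fun p hp => blockLabel_mem hp.1 hp.2, fun p hp q hq h => ?_, fun x hx => ?_⟩
  · have := (blockLabelEquiv n m).injective (a₁ := (⟨p.1, hp.1⟩, ⟨p.2, hp.2⟩))
      (a₂ := (⟨q.1, hq.1⟩, ⟨q.2, hq.2⟩)) (Subtype.ext h)
    simpa only [Prod.mk.injEq, Subtype.mk.injEq, ← Prod.ext_iff] using this
  · obtain ⟨⟨a, i⟩, h⟩ := (blockLabelEquiv n m).surjective ⟨x, hx⟩
    exact ⟨(a, i), ⟨a.2, i.2⟩, congrArg Subtype.val h⟩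

theorem bijOn_flip_blockLabel (n m : ℕ) : Set.BijOn (Function.uncurry fun i a => blockLabel m a i)
    (Finset.Icc 1 m ×ˢ Finset.Icc 1 n) (Finset.Icc 1 (n * m)) := by
  have hswap : Set.BijOn Prod.swap ((Finset.Icc 1 m : Set ℕ) ×ˢ (Finset.Icc 1 n : Set ℕ))
      ((Finset.Icc 1 n : Set ℕ) ×ˢ (Finset.Icc 1 m : Set ℕ)) := by
    rw [← Set.image_swap_prod (Finset.Icc 1 m : Set ℕ)]
    exact Prod.swap_injective.injOn.bijOn_image
  exact (bijOn_blockLabel n m).comp hswap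

/-- The two parities as the labels `1` and `2`. -/
def parityLabel : ZMod 2 ≃ Finset.Icc 1 2 where
  toFun b := ⟨b.val + 1, Finset.mem_Icc.2 ⟨Nat.le_add_left 1 _, b.val_lt⟩⟩
  invFun i := (i - 1 : ℕ)
  left_inv := by decide
  right_inv := by decide

theorem parityLabel_zero : (parityLabel 0 : ℕ) = 1 := rfl

theorem parityLabel_one : (parityLabel 1 : ℕ) = 2 := rfl

theorem one_le_parityLabel (b : ZMod 2) : 1 ≤ (parityLabel b : ℕ) := Nat.le_add_left 1 _

theorem partner_blockLabel (j : ℕ) (b : ZMod 2) :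
    partner (blockLabel 2 j (parityLabel b)) = blockLabel 2 j (parityLabel (b + 1)) := by
  obtain rfl | rfl := (by decide : ∀ b : ZMod 2, b = 0 ∨ b = 1) b
  · rw [zero_add, parityLabel_zero, parityLabel_one]
    exact if_pos ⟨j - 1, by rw [blockLabel, mul_comm]⟩
  · rw [CharTwo.add_self_eq_zero, parityLabel_zero, parityLabel_one]
    exact if_neg (Nat.not_odd_iff_even.2 ⟨j - 1 + 1, by rw [blockLabel]; ring⟩)

/-- The exchange of the first `m` and the last `m` of the numbers `1, …, 2 * m`. -/
def halfSwap (m I : ℕ) : ℕ := if I ≤ m then I + m else I - m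

theorem add_halfSwap (m I a : ℕ) :
    a + halfSwap m I = if I ≤ m then a + I + m else a + I - m := by
  rw [halfSwap]
  split_ifs <;> omega

theorem halfSwap_blockLabel {m i : ℕ} (hi : i ∈ Finset.Icc 1 m) (b : ZMod 2) :
    halfSwap m (blockLabel m (parityLabel b) i) = blockLabel m (parityLabel (b + 1)) i := by
  rw [Finset.mem_Icc] at hi
  obtain rfl | rfl := (by decide : ∀ b : ZMod 2, b = 0 ∨ b = 1) b
  · rw [zero_add, parityLabel_zero, parityLabel_one, halfSwap, blockLabel, blockLabel]
    grind
  · rw [CharTwo.add_self_eq_zero, parityLabel_zero, parityLabel_one, halfSwap, blockLabel,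
      blockLabel]
    grind

theorem mapsTo_partner (n : ℕ) :
    Set.MapsTo partner (Finset.Icc 1 (n * 2)) (Finset.Icc 1 (n * 2)) := by
  intro J hJ
  simp only [Finset.coe_Icc, Set.mem_Icc, partner] at hJ ⊢
  split_ifs with h <;> grind

theorem leftInvOn_partner (n : ℕ) :
    Set.LeftInvOn partner partner (Finset.Icc 1 n) := by
  intro J hJ
  simp only [Finset.coe_Icc, Set.mem_Icc, partner] at hJ ⊢
  grind

theorem mapsTo_halfSwap (m : ℕ) :
    Set.MapsTo (halfSwap m) (Finset.Icc 1 (2 * m)) (Finset.Icc 1 (2 * m)) := by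
  intro I hI
  simp only [Finset.coe_Icc, Set.mem_Icc, halfSwap] at hI ⊢
  split_ifs <;> omega

theorem leftInvOn_halfSwap (m : ℕ) :
    Set.LeftInvOn (halfSwap m) (halfSwap m) (Finset.Icc 1 (2 * m)) := by
  intro I hI
  simp only [Finset.coe_Icc, Set.mem_Icc, halfSwap] at hI ⊢
  split_ifs <;> omega

end Blocks

namespace Chromotopology

section Labels

variable {N : ℕ} {A : Chromotopology N} {m : ℕ} (l : A.Labeling m)

theorem rho_rho (c : Fin N) (w : A.White) : A.rho c (A.rho c w) = w := by
  rw [rho_eq_face, ← Perm.mul_apply]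
  nth_rw 1 [face_comm]
  rw [face_mul_face, face_self, Perm.one_apply]

theorem labeledRho_label (c : Fin N) (w : A.White) :
    labeledRho l c (l w : ℕ) = l (A.rho c w) :=
  Perm.extendDomain_apply_image _ _ _

theorem exists_label_eq {i : ℕ} (hi : i ∈ Finset.Icc 1 m) : ∃ w, (l w : ℕ) = i :=
  ⟨l.symm ⟨i, hi⟩, by rw [apply_symm_apply]⟩

theorem labeledRho_of_notMem (c : Fin N) {x : ℕ} (hx : x ∉ Finset.Icc 1 m) :
    labeledRho l c x = x :=
  Perm.extendDomain_apply_not_subtype _ _ hx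

theorem mem_of_labeledRho_ne {c : Fin N} {x : ℕ} (hx : labeledRho l c x ≠ x) :
    x ∈ Finset.Icc 1 m :=
  by_contra fun h => hx (labeledRho_of_notMem l c h)

theorem involutive_labeledRho (c : Fin N) : Function.Involutive (labeledRho l c) := by
  intro x
  by_cases hx : x ∈ Finset.Icc 1 m
  · obtain ⟨w, rfl⟩ := exists_label_eq l hx
    rw [labeledRho_label, labeledRho_label, rho_rho]
  · rw [labeledRho_of_notMem l c hx, labeledRho_of_notMem l c hx]

theorem exists_isTwoCycleDecomposition_labeledRho (c : Fin N) :
    ∃ L, IsTwoCycleDecomposition (labeledRho l c) L :=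
  exists_isTwoCycleDecomposition (involutive_labeledRho l c) fun _ => mem_of_labeledRho_ne l

theorem labeledRho_ne {c : Fin N} (hc : ∀ w, A.rho c w ≠ w) {i : ℕ} (hi : i ∈ Finset.Icc 1 m) :
    labeledRho l c i ≠ i := by
  obtain ⟨w, rfl⟩ := exists_label_eq l hi
  rw [labeledRho_label]
  exact fun h => hc w (l.injective (Subtype.ext h))

variable {l} in
theorem _root_.IsTwoCycleDecomposition.labeledRho_eq_orderedProd {c : Fin N}
    {L : List (ℕ × ℕ)} (hL : IsTwoCycleDecomposition (labeledRho l c) L)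
    (hc : ∀ w, A.rho c w ≠ w) {N' M n : ℕ} {B : Chromotopology N'} {l' : B.Labeling M}
    {d : Fin N'} {f : ℕ → ℕ → ℕ} {π : ℕ → ℕ}
    (hf : Set.BijOn (Function.uncurry f) (Finset.Icc 1 n ×ˢ Finset.Icc 1 m) (Finset.Icc 1 M))
    (hπ : Set.MapsTo π (Finset.Icc 1 n) (Finset.Icc 1 n))
    (hππ : Set.LeftInvOn π π (Finset.Icc 1 n))
    (h : ∀ J ∈ Finset.Icc 1 n, ∀ i ∈ Finset.Icc 1 m,
      labeledRho l' d (f J i) = f (π J) (labeledRho l c i)) :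
    labeledRho l' d = orderedProd n fun J => relabel L (f J) (f (π J)) := by
  refine hL.eq_orderedProd_relabel hπ hππ
    (hf.injOn.mono (Set.prod_mono_right fun _ => mem_of_labeledRho_ne l))
    (fun J hJ i hi => h J hJ i (mem_of_labeledRho_ne l hi))
    fun x hx => labeledRho_of_notMem l' d fun hmem => ?_
  obtain ⟨⟨J, i⟩, ⟨hJ, hi⟩, rfl⟩ := hf.surjOn hmem
  exact hx J hJ i (labeledRho_ne l hc hi) rfl

variable [NeZero N]

theorem whiteEnd_zero_edge_edge (c : Fin N) (v : A.V) :
    A.whiteEnd 0 (A.edge (finRotate N c) (A.edge c v)) = A.rho c (A.whiteEnd 0 v) := by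
  rw [whiteEnd_edge_eq_face, whiteEnd_edge_eq_face, ← Perm.mul_apply,
    face_comm _ 0 (finRotate N c), face_mul_face, face_comm, ← rho_eq_face]

theorem whiteEnd_zero_edge_of_succ_eq {c : Fin N} (hc : (c : ℕ) + 1 = N) (v : A.V) :
    A.whiteEnd 0 (A.edge c v) = A.rho c (A.whiteEnd 0 v) := by
  rw [whiteEnd_edge_eq_face, face_comm, rho_eq_face, finRotate_of_succ_eq hc]

/-- Numbers the vertices edge by edge along the edges of the first colour, each white vertex being
followed by its black neighbour. -/
def alternatingLabel (l : A.Labeling m) : A.V ≃ Finset.Icc 1 (m * 2) :=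
  (A.whiteEndEquiv 0).trans ((l.prodCongr parityLabel).trans (blockLabelEquiv m 2))

/-- Numbers first all white vertices and then, in the same order, their black neighbours along the
edges of the first colour. -/
def halvedLabel (l : A.Labeling m) : A.V ≃ Finset.Icc 1 (2 * m) :=
  (A.whiteEndEquiv 0).trans
    ((prodComm _ _).trans ((parityLabel.prodCongr l).trans (blockLabelEquiv 2 m)))

theorem alternatingLabel_apply (v : A.V) : (alternatingLabel l v : ℕ) =
    blockLabel 2 (l (A.whiteEnd 0 v)) (parityLabel (A.parity v)) := rfl

theorem halvedLabel_apply (v : A.V) : (halvedLabel l v : ℕ) =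
    blockLabel m (parityLabel (A.parity v)) (l (A.whiteEnd 0 v)) := rfl

theorem alternatingLabel_edge_zero (v : A.V) :
    (alternatingLabel l (A.edge 0 v) : ℕ) = partner (alternatingLabel l v) := by
  rw [alternatingLabel_apply, whiteEnd_edge, parity_edge, alternatingLabel_apply,
    partner_blockLabel]

theorem halvedLabel_edge_zero (v : A.V) :
    (halvedLabel l (A.edge 0 v) : ℕ) = halfSwap m (halvedLabel l v) := by
  rw [halvedLabel_apply, whiteEnd_edge, parity_edge, halvedLabel_apply,
    halfSwap_blockLabel (l _).2]

end Labels

section TensorRho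

variable {N₁ N₂ : ℕ} {A₁ : Chromotopology N₁} {A₂ : Chromotopology N₂}
  (w : (A₁.tensor A₂).White)

theorem tensor_rho_castAdd_of_succ_lt {c : Fin N₁} (hc : (c : ℕ) + 1 < N₁) :
    ((A₁.tensor A₂).rho (Fin.castAdd N₂ c) w).1 =
      (A₁.edge (finRotate N₁ c) (A₁.edge c w.1.1), w.1.2) := by
  have hrot : finRotate (N₁ + N₂) (Fin.castAdd N₂ c) = Fin.castAdd N₂ (finRotate N₁ c) := by
    rw [finRotate_of_succ_lt hc, finRotate_of_succ_lt (Nat.lt_add_right N₂ hc)]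
    rfl
  exact (congrArg₂ (A₁.tensor A₂).edge hrot (tensor_edge_castAdd A₁ A₂ c w.1)).trans
    (tensor_edge_castAdd A₁ A₂ _ _)

theorem tensor_rho_castAdd_of_succ_eq [NeZero N₂] {c : Fin N₁} (hc : (c : ℕ) + 1 = N₁) :
    ((A₁.tensor A₂).rho (Fin.castAdd N₂ c) w).1 = (A₁.edge c w.1.1, A₂.edge 0 w.1.2) := by
  have hrot : finRotate (N₁ + N₂) (Fin.castAdd N₂ c) = Fin.natAdd N₁ 0 := by
    rw [finRotate_of_succ_lt (by
      rw [Fin.val_castAdd, hc]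
      exact Nat.lt_add_of_pos_right (NeZero.pos N₂))]
    exact Fin.ext hc
  exact (congrArg₂ (A₁.tensor A₂).edge hrot (tensor_edge_castAdd A₁ A₂ c w.1)).trans
    (tensor_edge_natAdd A₁ A₂ _ _)

theorem tensor_rho_natAdd_of_succ_lt {c : Fin N₂} (hc : (c : ℕ) + 1 < N₂) :
    ((A₁.tensor A₂).rho (Fin.natAdd N₁ c) w).1 =
      (w.1.1, A₂.edge (finRotate N₂ c) (A₂.edge c w.1.2)) := by
  have hrot : finRotate (N₁ + N₂) (Fin.natAdd N₁ c) = Fin.natAdd N₁ (finRotate N₂ c) := by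
    rw [finRotate_of_succ_lt hc, finRotate_of_succ_lt (Nat.add_lt_add_left hc N₁)]
    rfl
  exact (congrArg₂ (A₁.tensor A₂).edge hrot (tensor_edge_natAdd A₁ A₂ c w.1)).trans
    (tensor_edge_natAdd A₁ A₂ _ _)

theorem tensor_rho_natAdd_of_succ_eq [NeZero N₁] {c : Fin N₂} (hc : (c : ℕ) + 1 = N₂) :
    ((A₁.tensor A₂).rho (Fin.natAdd N₁ c) w).1 = (A₁.edge 0 w.1.1, A₂.edge c w.1.2) := by
  have := NeZero.of_pos (Nat.add_pos_left (NeZero.pos N₁) N₂)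
  have hrot : finRotate (N₁ + N₂) (Fin.natAdd N₁ c) = Fin.castAdd N₂ 0 := by
    rw [finRotate_of_succ_eq (congrArg (N₁ + ·) hc)]
    rfl
  exact (congrArg₂ (A₁.tensor A₂).edge hrot (tensor_edge_natAdd A₁ A₂ c w.1)).trans
    (tensor_edge_castAdd A₁ A₂ _ _)

end TensorRho

section TensorLabeling

variable {N₁ N₂ : ℕ} {A₁ : Chromotopology N₁} {A₂ : Chromotopology N₂}

theorem tensor_parity_eq_zero_iff {v : A₁.V × A₂.V} :
    (A₁.tensor A₂).parity v = 0 ↔ A₁.parity v.1 = A₂.parity v.2 :=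
  CharTwo.add_eq_zero

variable (A₁ A₂) in
/-- A white vertex of the tensor product is given by a vertex of `A₂` and the white end of an edge
of the first colour in the copy of `A₁` there; the colours of the copy are determined by the vertex
of `A₂`. -/
def tensorWhiteEquiv [NeZero N₁] : (A₁.tensor A₂).White ≃ A₂.V × A₁.White where
  toFun w := (w.1.2, A₁.whiteEnd 0 w.1.1)
  invFun p := ⟨(A₁.edgeEnd 0 p.2 (A₂.parity p.1), p.1),
    tensor_parity_eq_zero_iff.2 (A₁.parity_edgeEnd _ _ _)⟩
  left_inv w := White.ext (Prod.ext
    ((congrArg (A₁.edgeEnd 0 _) (tensor_parity_eq_zero_iff.1 w.2).symm).trans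
      (A₁.edgeEnd_whiteEnd _ _)) rfl)
  right_inv _ := Prod.ext rfl (A₁.whiteEnd_edgeEnd _ _ _)

variable [NeZero N₁] [NeZero N₂]
variable {m₁ m₂ : ℕ} (l₁ : A₁.Labeling m₁) (l₂ : A₂.Labeling m₂)

/-- Numbers the white vertices copy by copy, the copies of `A₁` being taken in the order given by
`alternatingLabel` on the vertices of `A₂`. -/
def tensorLabeling : (A₁.tensor A₂).Labeling (m₂ * 2 * m₁) :=
  (tensorWhiteEquiv A₁ A₂).trans
    (((alternatingLabel l₂).prodCongr l₁).trans (blockLabelEquiv (m₂ * 2) m₁))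

theorem tensorLabeling_eq_left (w : (A₁.tensor A₂).White) : (tensorLabeling l₁ l₂ w : ℕ) =
    blockLabel m₁ (alternatingLabel l₂ w.1.2) (l₁ (A₁.whiteEnd 0 w.1.1)) := rfl

theorem tensorLabeling_eq_right (w : (A₁.tensor A₂).White) : (tensorLabeling l₁ l₂ w : ℕ) =
    blockLabel (2 * m₁) (l₂ (A₂.whiteEnd 0 w.1.2)) (halvedLabel l₁ w.1.1) := by
  rw [tensorLabeling_eq_left, alternatingLabel_apply, halvedLabel_apply,
    tensor_parity_eq_zero_iff.1 w.2, blockLabel_blockLabel _ _ _ (one_le_parityLabel _)]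

theorem exists_coordinates_eq_left {J i : ℕ} (hJ : J ∈ Finset.Icc 1 (m₂ * 2))
    (hi : i ∈ Finset.Icc 1 m₁) : ∃ w : (A₁.tensor A₂).White,
      (alternatingLabel l₂ w.1.2 : ℕ) = J ∧ (l₁ (A₁.whiteEnd 0 w.1.1) : ℕ) = i := by
  obtain ⟨w, hw⟩ := ((tensorWhiteEquiv A₁ A₂).trans
    ((alternatingLabel l₂).prodCongr l₁)).surjective (⟨J, hJ⟩, ⟨i, hi⟩)
  exact ⟨w, congrArg (·.1.1) hw, congrArg (·.2.1) hw⟩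

theorem exists_coordinates_eq_right {I j : ℕ} (hI : I ∈ Finset.Icc 1 (2 * m₁))
    (hj : j ∈ Finset.Icc 1 m₂) : ∃ w : (A₁.tensor A₂).White,
      (halvedLabel l₁ w.1.1 : ℕ) = I ∧ (l₂ (A₂.whiteEnd 0 w.1.2) : ℕ) = j := by
  obtain ⟨v, hv⟩ := (halvedLabel l₁).surjective ⟨I, hI⟩
  exact ⟨⟨(v, A₂.edgeEnd 0 (l₂.symm ⟨j, hj⟩) (A₁.parity v)),
    tensor_parity_eq_zero_iff.2 (A₂.parity_edgeEnd _ _ _).symm⟩, congrArg Subtype.val hv, by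
    rw [whiteEnd_edgeEnd, apply_symm_apply]⟩

theorem labeledRho_tensorLabeling_castAdd_of_succ_lt {c : Fin N₁} (hc : (c : ℕ) + 1 < N₁) {J i : ℕ}
    (hJ : J ∈ Finset.Icc 1 (m₂ * 2)) (hi : i ∈ Finset.Icc 1 m₁) :
    labeledRho (tensorLabeling l₁ l₂) (Fin.castAdd N₂ c) (blockLabel m₁ J i) =
      blockLabel m₁ J (labeledRho l₁ c i) := by
  obtain ⟨w, rfl, rfl⟩ := exists_coordinates_eq_left l₁ l₂ hJ hi
  rw [← tensorLabeling_eq_left, labeledRho_label, labeledRho_label, tensorLabeling_eq_left,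
    tensor_rho_castAdd_of_succ_lt w hc, whiteEnd_zero_edge_edge]

theorem labeledRho_tensorLabeling_castAdd_of_succ_eq {c : Fin N₁} (hc : (c : ℕ) + 1 = N₁) {J i : ℕ}
    (hJ : J ∈ Finset.Icc 1 (m₂ * 2)) (hi : i ∈ Finset.Icc 1 m₁) :
    labeledRho (tensorLabeling l₁ l₂) (Fin.castAdd N₂ c) (blockLabel m₁ J i) =
      blockLabel m₁ (partner J) (labeledRho l₁ c i) := by
  obtain ⟨w, rfl, rfl⟩ := exists_coordinates_eq_left l₁ l₂ hJ hi
  rw [← tensorLabeling_eq_left, labeledRho_label, labeledRho_label, tensorLabeling_eq_left,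
    tensor_rho_castAdd_of_succ_eq w hc, whiteEnd_zero_edge_of_succ_eq hc,
    alternatingLabel_edge_zero]

theorem labeledRho_tensorLabeling_natAdd_of_succ_lt {c : Fin N₂} (hc : (c : ℕ) + 1 < N₂) {I j : ℕ}
    (hI : I ∈ Finset.Icc 1 (2 * m₁)) (hj : j ∈ Finset.Icc 1 m₂) :
    labeledRho (tensorLabeling l₁ l₂) (Fin.natAdd N₁ c) (blockLabel (2 * m₁) j I) =
      blockLabel (2 * m₁) (labeledRho l₂ c j) I := by
  obtain ⟨w, rfl, rfl⟩ := exists_coordinates_eq_right l₁ l₂ hI hj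
  rw [← tensorLabeling_eq_right, labeledRho_label, labeledRho_label, tensorLabeling_eq_right,
    tensor_rho_natAdd_of_succ_lt w hc, whiteEnd_zero_edge_edge]

theorem labeledRho_tensorLabeling_natAdd_of_succ_eq {c : Fin N₂} (hc : (c : ℕ) + 1 = N₂) {I j : ℕ}
    (hI : I ∈ Finset.Icc 1 (2 * m₁)) (hj : j ∈ Finset.Icc 1 m₂) :
    labeledRho (tensorLabeling l₁ l₂) (Fin.natAdd N₁ c) (blockLabel (2 * m₁) j I) =
      blockLabel (2 * m₁) (labeledRho l₂ c j) (halfSwap m₁ I) := by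
  obtain ⟨w, rfl, rfl⟩ := exists_coordinates_eq_right l₁ l₂ hI hj
  rw [← tensorLabeling_eq_right, labeledRho_label, labeledRho_label, tensorLabeling_eq_right,
    tensor_rho_natAdd_of_succ_eq w hc, whiteEnd_zero_edge_of_succ_eq hc, halvedLabel_edge_zero]

variable {l₁ l₂} {L : List (ℕ × ℕ)}

theorem labeledRho_castAdd_eq_orderedProd_of_succ_lt {c : Fin N₁} (hc : (c : ℕ) + 1 < N₁)
    (hρ : ∀ w, A₁.rho c w ≠ w) (hL : IsTwoCycleDecomposition (labeledRho l₁ c) L) :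
    labeledRho (tensorLabeling l₁ l₂) (Fin.castAdd N₂ c) =
      orderedProd (m₂ * 2) fun J => relabel L (blockLabel m₁ J) (blockLabel m₁ J) :=
  hL.labeledRho_eq_orderedProd hρ (bijOn_blockLabel _ _) (Set.mapsTo_id _) (fun _ _ => rfl)
    fun _ hJ _ hi => labeledRho_tensorLabeling_castAdd_of_succ_lt l₁ l₂ hc hJ hi

theorem labeledRho_castAdd_eq_orderedProd_of_succ_eq {c : Fin N₁} (hc : (c : ℕ) + 1 = N₁)
    (hρ : ∀ w, A₁.rho c w ≠ w) (hL : IsTwoCycleDecomposition (labeledRho l₁ c) L) :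
    labeledRho (tensorLabeling l₁ l₂) (Fin.castAdd N₂ c) =
      orderedProd (m₂ * 2) fun J => relabel L (blockLabel m₁ J) (blockLabel m₁ (partner J)) :=
  hL.labeledRho_eq_orderedProd hρ (bijOn_blockLabel _ _) (mapsTo_partner m₂) (leftInvOn_partner _)
    fun _ hJ _ hi => labeledRho_tensorLabeling_castAdd_of_succ_eq l₁ l₂ hc hJ hi

theorem labeledRho_natAdd_eq_orderedProd_of_succ_lt {c : Fin N₂} (hc : (c : ℕ) + 1 < N₂)
    (hρ : ∀ w, A₂.rho c w ≠ w) (hL : IsTwoCycleDecomposition (labeledRho l₂ c) L) :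
    labeledRho (tensorLabeling l₁ l₂) (Fin.natAdd N₁ c) = orderedProd (2 * m₁) fun I =>
      relabel L (blockLabel (2 * m₁) · I) (blockLabel (2 * m₁) · I) :=
  hL.labeledRho_eq_orderedProd hρ (f := fun I j => blockLabel (2 * m₁) j I)
    (mul_assoc m₂ 2 m₁ ▸ bijOn_flip_blockLabel m₂ (2 * m₁)) (Set.mapsTo_id _) (fun _ _ => rfl)
    fun _ hI _ hj => labeledRho_tensorLabeling_natAdd_of_succ_lt l₁ l₂ hc hI hj

theorem labeledRho_natAdd_eq_orderedProd_of_succ_eq {c : Fin N₂} (hc : (c : ℕ) + 1 = N₂)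
    (hρ : ∀ w, A₂.rho c w ≠ w) (hL : IsTwoCycleDecomposition (labeledRho l₂ c) L) :
    labeledRho (tensorLabeling l₁ l₂) (Fin.natAdd N₁ c) = orderedProd (2 * m₁) fun I =>
      relabel L (blockLabel (2 * m₁) · I) (blockLabel (2 * m₁) · (halfSwap m₁ I)) :=
  hL.labeledRho_eq_orderedProd hρ (f := fun I j => blockLabel (2 * m₁) j I)
    (mul_assoc m₂ 2 m₁ ▸ bijOn_flip_blockLabel m₂ (2 * m₁)) (mapsTo_halfSwap m₁)
    (leftInvOn_halfSwap m₁)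
    fun _ hI _ hj => labeledRho_tensorLabeling_natAdd_of_succ_eq l₁ l₂ hc hI hj

end TensorLabeling

end Chromotopology

end

theorem mainTheorem10 {N₁ N₂ k₁ k₂ : ℕ} (hN₁ : 0 < N₁) (hN₂ : 0 < N₂)
    (C₁ : Submodule (ZMod 2) (Fin N₁ → ZMod 2)) (C₂ : Submodule (ZMod 2) (Fin N₂ → ZMod 2))
    (h₁ : DoublyEven C₁) (h₂ : DoublyEven C₂)
    (hk₁ : Module.finrank (ZMod 2) C₁ = k₁) (hk₂ : Module.finrank (ZMod 2) C₂ = k₂)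
    (A₁ : Chromotopology N₁) (hA₁ : A₁ = Chromotopology.ofCode C₁ h₁)
    (A₂ : Chromotopology N₂) (hA₂ : A₂ = Chromotopology.ofCode C₂ h₂)
    (A : Chromotopology (N₁ + N₂)) (hA : A = A₁.tensor A₂)
    (m₁ m₂ : ℕ) (hm₁ : m₁ = 2 ^ (N₁ - k₁ - 1)) (hm₂ : m₂ = 2 ^ (N₂ - k₂ - 1)) :
    -- the tensor product is an `(N₁ + N₂, k₁ + k₂)` chromotopology
    (∃ (C : Submodule (ZMod 2) (Fin (N₁ + N₂) → ZMod 2)) (h : DoublyEven C),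
      Module.finrank (ZMod 2) C = k₁ + k₂ ∧
        Nonempty (A.Iso (Chromotopology.ofCode C h))) ∧
    -- the face permutations generate the monodromy groups
    A₁.MonodromyGeneratedBy {σ | ∃ c : Fin N₁, (c : ℕ) + 1 < N₁ ∧ σ = A₁.rho c} ∧
    A₂.MonodromyGeneratedBy {σ | ∃ c : Fin N₂, (c : ℕ) + 1 < N₂ ∧ σ = A₂.rho c} ∧
    A.MonodromyGeneratedBy {σ | ∃ c : Fin (N₁ + N₂), (c : ℕ) + 1 < N₁ + N₂ ∧ σ = A.rho c} ∧
    -- the white vertices of the factors can be labelled, and the `ρ_c` of the factors are products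
    -- of disjoint 2-cycles
    Nonempty (A₁.Labeling m₁) ∧ Nonempty (A₂.Labeling m₂) ∧
    (2 ≤ N₁ → ∀ (l₁ : A₁.Labeling m₁) (c : Fin N₁),
      ∃ L, IsTwoCycleDecomposition (Chromotopology.labeledRho l₁ c) L) ∧
    (2 ≤ N₂ → ∀ (l₂ : A₂.Labeling m₂) (c : Fin N₂),
      ∃ L, IsTwoCycleDecomposition (Chromotopology.labeledRho l₂ c) L) ∧
    -- for all labellings of the factors there is a labelling of the tensor product such that
    ∀ (l₁ : A₁.Labeling m₁) (l₂ : A₂.Labeling m₂),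
      ∃ l : A.Labeling (2 ^ (N₁ + N₂ - (k₁ + k₂) - 1)),
        -- `ρ_c` for `1 ≤ c ≤ N₁ - 1`
        (∀ c : Fin N₁, (c : ℕ) + 1 < N₁ →
          ∀ L, IsTwoCycleDecomposition (Chromotopology.labeledRho l₁ c) L →
            Chromotopology.labeledRho l (Fin.castAdd N₂ c) =
              orderedProd (2 ^ (N₂ - k₂)) fun j =>
                relabel L (fun i => (j - 1) * m₁ + i) (fun i => (j - 1) * m₁ + i)) ∧
        -- `ρ_{N₁ + c}` for `1 ≤ c ≤ N₂ - 1`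
        (∀ c : Fin N₂, (c : ℕ) + 1 < N₂ →
          ∀ L, IsTwoCycleDecomposition (Chromotopology.labeledRho l₂ c) L →
            Chromotopology.labeledRho l (Fin.natAdd N₁ c) =
              orderedProd (2 ^ (N₁ - k₁)) fun i =>
                relabel L (fun j => (j - 1) * 2 ^ (N₁ - k₁) + i)
                  (fun j => (j - 1) * 2 ^ (N₁ - k₁) + i)) ∧
        -- `ρ_{N₁}`, as a product of 2-cycles and entry by entry
        (∀ c : Fin N₁, (c : ℕ) + 1 = N₁ →
          (2 ≤ N₁ → ∀ L, IsTwoCycleDecomposition (Chromotopology.labeledRho l₁ c) L →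
            Chromotopology.labeledRho l (Fin.castAdd N₂ c) =
              orderedProd (2 ^ (N₂ - k₂)) fun J =>
                relabel L (fun i => (J - 1) * m₁ + i) (fun i => (partner J - 1) * m₁ + i)) ∧
          ∀ J ∈ Finset.Icc 1 (2 ^ (N₂ - k₂)), ∀ i ∈ Finset.Icc 1 m₁,
            Chromotopology.labeledRho l (Fin.castAdd N₂ c) ((J - 1) * m₁ + i) =
              (partner J - 1) * m₁ + Chromotopology.labeledRho l₁ c i) ∧
        -- `ρ_{N₁ + N₂}`, as the product of the others, as a product of 2-cycles and entry by entry
        (∀ c : Fin N₂, (c : ℕ) + 1 = N₂ →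
          A.rho (Fin.natAdd N₁ c) = ((List.finRange (N₁ + N₂)).dropLast.map A.rho).prod ∧
          (2 ≤ N₂ → ∀ L, IsTwoCycleDecomposition (Chromotopology.labeledRho l₂ c) L →
            Chromotopology.labeledRho l (Fin.natAdd N₁ c) =
              orderedProd (2 ^ (N₁ - k₁)) fun I =>
                relabel L (fun j => (j - 1) * 2 ^ (N₁ - k₁) + I)
                  (fun j => if I ≤ m₁ then (j - 1) * 2 ^ (N₁ - k₁) + I + m₁
                    else (j - 1) * 2 ^ (N₁ - k₁) + I - m₁)) ∧
          ∀ I ∈ Finset.Icc 1 (2 ^ (N₁ - k₁)), ∀ j ∈ Finset.Icc 1 m₂,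
            Chromotopology.labeledRho l (Fin.natAdd N₁ c) ((j - 1) * 2 ^ (N₁ - k₁) + I) =
              if I ≤ m₁ then
                (Chromotopology.labeledRho l₂ c j - 1) * 2 ^ (N₁ - k₁) + I + m₁
              else (Chromotopology.labeledRho l₂ c j - 1) * 2 ^ (N₁ - k₁) + I - m₁) := by
  subst hA hA₁ hA₂ hk₁ hk₂ hm₁ hm₂
  have := NeZero.of_pos hN₁
  have := NeZero.of_pos hN₂
  have := NeZero.of_pos (Nat.add_pos_left hN₁ N₂)
  rw [h₁.two_pow_add_sub_finrank_add h₂, h₁.two_pow_sub_finrank, h₂.two_pow_sub_finrank,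
    mul_comm 2 (2 ^ (N₂ - Module.finrank (ZMod 2) C₂ - 1))]
  simp only [← add_halfSwap]
  have hA₁ := Chromotopology.connected_ofCode h₁
  have hA₂ := Chromotopology.connected_ofCode h₂
  have hρ₁ (hN : 2 ≤ N₁) := Chromotopology.rho_ofCode_ne h₁ hN
  have hρ₂ (hN : 2 ≤ N₂) := Chromotopology.rho_ofCode_ne h₂ hN
  open Chromotopology in
  exact ⟨⟨_, doublyEven_ker_tensorMap h₁ h₂, finrank_ker_tensorMap C₁ C₂, ⟨(tensorIso h₁ h₂).symm⟩⟩,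
    hA₁.monodromyGeneratedBy, hA₂.monodromyGeneratedBy, (hA₁.tensor hA₂).monodromyGeneratedBy,
    nonempty_labeling_ofCode h₁, nonempty_labeling_ofCode h₂,
    fun _ => exists_isTwoCycleDecomposition_labeledRho,
    fun _ => exists_isTwoCycleDecomposition_labeledRho,
    fun l₁ l₂ => ⟨tensorLabeling l₁ l₂,
      fun c hc L => labeledRho_castAdd_eq_orderedProd_of_succ_lt hc (hρ₁ (by omega) c),
      fun c hc L => labeledRho_natAdd_eq_orderedProd_of_succ_lt hc (hρ₂ (by omega) c),
      fun c hc => ⟨fun hN L => labeledRho_castAdd_eq_orderedProd_of_succ_eq hc (hρ₁ hN c),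
        fun J hJ i hi => labeledRho_tensorLabeling_castAdd_of_succ_eq l₁ l₂ hc hJ hi⟩,
      fun c hc => ⟨rho_last_eq_prod _ (congrArg (N₁ + ·) hc),
        fun hN L => labeledRho_natAdd_eq_orderedProd_of_succ_eq hc (hρ₂ hN c),
        fun I hI j hj => labeledRho_tensorLabeling_natAdd_of_succ_eq l₁ l₂ hc hI hj⟩⟩⟩
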